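/- Write $\mathcal R_a=[0,a]\times[0,1]\subset\mathbb C$. For $R>T>0$, a conformal embedding of $\mathcal R_R$ into $\mathcal R_T$ is a homeomorphism $E$ of $\mathcal R_R$ onto a closed Jordan domain $E(\mathcal R_R)\subset\mathcal R_T$ (the shape), conformal in the interior, which maps the vertices $0,R,R+i,i$ to quad-vertices $0,p_1,p_2,i$ with $p_1,p_2\in\{T\}\times[0,1]$ and $\operatorname{Im}p_1<\operatorname{Im}p_2$, the left side $[0,i]$ onto $[0,i]$ and the right side $[R,R+i]$ onto the segment $[p_1,p_2]$. If $[0,1]^2\subset E(\mathcal R_R)$ and $\varepsilon>0$, the shape is called $\varepsilon$-admissible if there is a homeomorphism $\alpha$ of $E(\mathcal R_R)$ onto itself that is $K$-quasiconformal in the interior for some $K<1+\varepsilon$, fixes the four quad-vertices $0,p_1,p_2,i$, and satisfies $\alpha(E(z))=z$ for all $z\in[0,1]^2$. Here $K$-quasiconformal ($K\ge1$) means: an orientation-preserving homeomorphism with locally integrable distributional derivatives $\alpha_z,\alpha_{\bar z}$ such that $|\alpha_{\bar z}|\le\frac{K-1}{K+1}|\alpha_z|$ almost everywhere; its dilatation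 is $\mu_\alpha=\alpha_{\bar z}/\alpha_z$. Proposition. There is an absolute constant $C>0$ such that the following holds. Let $T\ge 6$, let $M\ge2$ be a natural number with $2M<T$, let $R>T$, and let $E$ be a conformal embedding of $\mathcal R_R$ into $\mathcal R_T$ whose shape contains $[0,2M]\times[0,1]$. Then the shape $E(\mathcal R_R)$ is $\varepsilon$-admissible with $$\varepsilon=C\,\frac{e^{-\pi(M-1)/2}}{M},$$ and the map $\alpha$ can moreover be chosen so that its dilatation $\mu_\alpha$ vanishes almost everywhere outside $[0,M]\times[0,1]$. -/

import Mathlib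

open Set MeasureTheory
open scoped ContDiff

noncomputable section

namespace AdmissibleShapes

/-- The closed rectangle `[0,a] × [0,1]`. -/
def rect (a : ℝ) : Set ℂ := {z | z.re ∈ Icc 0 a ∧ z.im ∈ Icc (0 : ℝ) 1}

/-- The open rectangle `(0,a) × (0,1)`. -/
def openRect (a : ℝ) : Set ℂ := {z | z.re ∈ Ioo 0 a ∧ z.im ∈ Ioo (0 : ℝ) 1}

/-- The vertical segment `{x} × [0,1]`. -/
def vertSide (x : ℝ) : Set ℂ := {z | z.re = x ∧ z.im ∈ Icc (0 : ℝ) 1}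

/-! ### Quasiconformal maps (analytic definition) -/

/-- The Wirtinger derivative `∂φ = (φ_x - i φ_y) / 2` of a real-differentiable function. -/
def wirtinger (φ : ℂ → ℂ) (z : ℂ) : ℂ :=
  (fderiv ℝ φ z 1 - Complex.I * fderiv ℝ φ z Complex.I) / 2

/-- The Wirtinger derivative `∂̄φ = (φ_x + i φ_y) / 2` of a real-differentiable function. -/
def wirtingerBar (φ : ℂ → ℂ) (z : ℂ) : ℂ :=
  (fderiv ℝ φ z 1 + Complex.I * fderiv ℝ φ z Complex.I) / 2

/-- `p` and `q` are locally integrable and are the distributional derivatives `f_z` and `f_z̄`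
of `f` on the open set `Ω`. -/
structure IsWeakWirtinger (f : ℂ → ℂ) (Ω : Set ℂ) (p q : ℂ → ℂ) : Prop where
  locInt_p : LocallyIntegrableOn p Ω
  locInt_q : LocallyIntegrableOn q Ω
  weak_p : ∀ φ : ℂ → ℂ, ContDiff ℝ ∞ φ → HasCompactSupport φ → tsupport φ ⊆ Ω →
    ∫ z, f z * wirtinger φ z = -∫ z, p z * φ z
  weak_q : ∀ φ : ℂ → ℂ, ContDiff ℝ ∞ φ → HasCompactSupport φ → tsupport φ ⊆ Ω →
    ∫ z, f z * wirtingerBar φ z = -∫ z, q z * φ z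

/-- `f` has local degree one in `Ω`: as `w` runs once counterclockwise around a circle bounding
a closed disc in `Ω` with centre `z`, the argument of `f w - f z` increases by `2π`. -/
def OrientationPreservingOn (f : ℂ → ℂ) (Ω : Set ℂ) : Prop :=
  ∀ z ∈ Ω, ∀ r : ℝ, 0 < r → Metric.closedBall z r ⊆ Ω →
    ∃ θ : ℝ → ℝ, Continuous θ ∧
      (∀ t : ℝ, f (circleMap z r t) - f z =
        (‖f (circleMap z r t) - f z‖ : ℂ) * Complex.exp (θ t * Complex.I)) ∧
      θ (2 * Real.pi) = θ 0 + 2 * Real.pi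

/-- `f` restricts to a `K`-quasiconformal map of the open set `Ω` onto the open set `Ω'`. -/
structure IsQuasiconformal (K : ℝ) (f : ℂ → ℂ) (Ω Ω' : Set ℂ) : Prop where
  one_le : 1 ≤ K
  homeo : ∃ e : OpenPartialHomeomorph ℂ ℂ, e.source = Ω ∧ e.target = Ω' ∧ EqOn f e Ω
  orientation : OrientationPreservingOn f Ω
  beltrami : ∃ p q : ℂ → ℂ, IsWeakWirtinger f Ω p q ∧
    ∀ᵐ z ∂volume.restrict Ω, ‖q z‖ ≤ (K - 1) / (K + 1) * ‖p z‖

/-- `μ` is the dilatation (Beltrami coefficient) `f_z̄ / f_z` of `f` on `Ω`. -/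
def IsDilatation (f : ℂ → ℂ) (Ω : Set ℂ) (μ : ℂ → ℂ) : Prop :=
  ∃ p q : ℂ → ℂ, IsWeakWirtinger f Ω p q ∧ ∀ᵐ z ∂volume.restrict Ω, μ z = q z / p z

/-- The dilatation of `f` on `Ω` vanishes almost everywhere outside `A`. -/
def DilatationSupportedIn (f : ℂ → ℂ) (Ω A : Set ℂ) : Prop :=
  ∃ μ : ℂ → ℂ, IsDilatation f Ω μ ∧ ∀ᵐ z ∂volume.restrict Ω, z ∉ A → μ z = 0

/-! ### Shapes -/

/-- `E` is a conformal embedding of `[0,R] × [0,1]` into `[0,T] × [0,1]`, where `T < R`: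
a homeomorphism of the closed rectangle onto a closed Jordan domain in `[0,T] × [0,1]`,
conformal inside, sending the vertices `0, R, R + i, i` to the quad-vertices `0, p₁, p₂, i`, where
`p₁, p₂ ∈ {T} × [0,1]` and `Im p₁ < Im p₂`, the left side to `[0,i]` and the right side to
`[p₁,p₂]`. The two remaining sides `γ₁, γ₂` of the quadrilateral are the images of the
horizontal sides. The shape is `E '' rect R`. -/
structure IsConformalEmbedding (R T : ℝ) (E : ℂ → ℂ) : Prop where
  pos : 0 < T
  lt : T < R
  continuousOn : ContinuousOn E (rect R)
  injOn : InjOn E (rect R)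
  holo : DifferentiableOn ℂ E (openRect R)
  mapsTo : MapsTo E (rect R) (rect T)
  map_zero : E 0 = 0
  map_I : E Complex.I = Complex.I
  re_p₁ : (E R).re = T
  re_p₂ : (E (R + Complex.I)).re = T
  im_lt : (E R).im < (E (R + Complex.I)).im
  left_side : E '' vertSide 0 = vertSide 0
  right_side : E '' vertSide R = segment ℝ (E R) (E (R + Complex.I))

/-- `α` is a map that exhibits the shape `E '' rect R` as `ε`-admissible: a self-homeomorphism of
the closed shape, quasiconformal inside with maximal dilatation less than `1 + ε`, that fixes the
four quad-vertices and for which `α ∘ E` is the identity on `[0,1]²`. -/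
structure IsAdmissibleMap (ε R T : ℝ) (E α : ℂ → ℂ) : Prop where
  embedding : IsConformalEmbedding R T E
  square_subset : rect 1 ⊆ E '' rect R
  continuousOn : ContinuousOn α (E '' rect R)
  bijOn : BijOn α (E '' rect R) (E '' rect R)
  fix_vertices : ∀ v ∈ ({0, (R : ℂ), (R : ℂ) + Complex.I, Complex.I} : Set ℂ), α (E v) = E v
  comp_eq_id : EqOn (α ∘ E) id (rect 1)
  quasiconformal : ∃ K : ℝ, K < 1 + ε ∧
    IsQuasiconformal K α (E '' openRect R) (E '' openRect R)

end AdmissibleShapes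

end

/-! The map `α` has to be `E⁻¹` near the unit square and may be the identity further right, so
everything rests on `E⁻¹` being exponentially close to the identity near the left side.

Let `F = E⁻¹` on `[0,L] × [0,1]`, `L = 2M`. Since `F` respects both horizontal sides and the left
side, `G = F - id` is real on the horizontal sides and imaginary on the left side. Such a
holomorphic function is a real series `∑ aₙ sinh (π(n+1)w)` (`exists_hasSum_sinh`). The only a
priori bound is `|Im G| ≤ 1`, as both ordinates lie in `[0,1]`; read off on `Re = L` it gives `|aₙ|
≤ 4 exp(-π(n+1)L)`. Hence the series defines a function `H` on the strip `|Re z| < 5/2` of size at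
most `5q`, with `q = exp(-π(L - 5/2))`.

Put `α z = z + χ(Re z) H z` with a cutoff `χ` vanishing for `Re z ≥ 2`. The perturbation is a
contraction, so `α` is a homeomorphism of the plane. The boundary symmetries of `H` make it preserve
the half-strip `Re ≥ 0`, `0 ≤ Im ≤ 1`, with which the shape coincides for `Re < 2`; to the right `α`
is the identity, so the shape is preserved as well. As `H` is holomorphic, `∂̄α = χ'H/2`, which is
of order `q` and lives in `|Re z| ≤ 2`. Finally `q` is far smaller than `exp(-π(M-1)/2)/M`. -/

noncomputable section

namespace AdmissibleShapes

open Complex Topology Filter ComplexConjugate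

/-! ### Topology and holomorphy of embeddings of rectangles -/

/-- There is no continuous logarithm of `r * u` on the unit circle. -/
lemma not_exists_continuous_log_circle (r : ℂ) :
    ¬ ∃ L : Circle → ℂ, Continuous L ∧ ∀ u : Circle, exp (L u) = r * u := by
  rintro ⟨L, hL, h⟩
  -- Both sides lift the path `r * exp (it)` through `exp` and agree at `0`; the right side fails to
  -- be `2π`-periodic.
  have key : (fun t : ℝ => L (Circle.exp t)) = fun t : ℝ => t * I + L 1 := by
    refine isCoveringMap_exp.eq_of_comp_eq (by fun_prop) (by fun_prop) ?_ 0 (by simp)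
    funext t
    apply Subtype.ext
    simp only [Function.comp_apply, h, exp_add, Circle.coe_exp]
    simp
    ring
  have := congrFun key (2 * Real.pi)
  simp [Real.pi_ne_zero] at this

lemma isCompact_rect (a : ℝ) : IsCompact (rect a) := by
  have : rect a = Icc 0 a ×ℂ Icc 0 1 := rfl
  rw [this]
  exact isCompact_Icc.reProdIm isCompact_Icc

lemma isOpen_openRect (a : ℝ) : IsOpen (openRect a) := by
  have : openRect a = Ioo 0 a ×ℂ Ioo 0 1 := rfl
  rw [this]
  exact isOpen_Ioo.reProdIm isOpen_Ioo

lemma openRect_subset_rect (a : ℝ) : openRect a ⊆ rect a :=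
  fun _ hz => ⟨Ioo_subset_Icc_self hz.1, Ioo_subset_Icc_self hz.2⟩

lemma rect_mono {a b : ℝ} (h : a ≤ b) : rect a ⊆ rect b :=
  fun _ hz => ⟨⟨hz.1.1, hz.1.2.trans h⟩, hz.2⟩

lemma convex_openRect (a : ℝ) : Convex ℝ (openRect a) :=
  ((convex_Ioo 0 a).linear_preimage reLm).inter ((convex_Ioo 0 1).linear_preimage imLm)

lemma interior_rect (a : ℝ) : interior (rect a) = openRect a := by
  have : rect a = Icc 0 a ×ℂ Icc 0 1 := rfl
  rw [this, interior_reProdIm, interior_Icc, interior_Icc]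
  rfl

/-- Contracting a point of the closed rectangle towards an interior point gives an interior
point. -/
lemma contract_mem_openRect {a s : ℝ} {c z : ℂ} (hc : c ∈ openRect a) (hz : z ∈ rect a)
    (hs : s ∈ Ico (0 : ℝ) 1) : c + s * (z - c) ∈ openRect a := by
  obtain ⟨⟨h1, h2⟩, h3, h4⟩ := hc
  obtain ⟨⟨h5, h6⟩, h7, h8⟩ := hz
  obtain ⟨h9, h10⟩ := hs
  have e1 : (c + s * (z - c)).re = (1 - s) * c.re + s * z.re := by simp; ring
  have e2 : (c + s * (z - c)).im = (1 - s) * c.im + s * z.im := by simp; ring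
  refine ⟨⟨?_, ?_⟩, ?_, ?_⟩ <;> first | rw [e1] | rw [e2]
  all_goals nlinarith

/-- The inverse of a continuous injection of a compact set is continuous. -/
lemma continuousOn_invFunOn_image {K : Set ℂ} (hK : IsCompact K) {E : ℂ → ℂ}
    (hE : ContinuousOn E K) (hinj : InjOn E K) :
    ContinuousOn (Function.invFunOn E K) (E '' K) := by
  rw [continuousOn_iff_isClosed]
  intro t ht
  refine ⟨E '' (K ∩ t), ((hK.inter_right ht).image_of_continuousOn
    (hE.mono inter_subset_left)).isClosed, ?_⟩
  ext w
  constructor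
  · rintro ⟨hw, z, hz, rfl⟩
    rw [mem_preimage, hinj.leftInvOn_invFunOn hz] at hw
    exact ⟨⟨z, ⟨hz, hw⟩, rfl⟩, z, hz, rfl⟩
  · rintro ⟨⟨z, ⟨hz, hw⟩, rfl⟩, -⟩
    refine ⟨?_, z, hz, rfl⟩
    rwa [mem_preimage, hinj.leftInvOn_invFunOn hz]

/-- A continuous injection of a closed rectangle does not map a boundary point to an interior
point of the image. -/
lemma image_notMem_nhds_of_boundary {a : ℝ} (ha : 0 < a) {E : ℂ → ℂ}
    (hE : ContinuousOn E (rect a)) (hinj : InjOn E (rect a)) {ζ : ℂ} (hζ : ζ ∈ rect a)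
    (hζ' : ζ ∉ openRect a) : E '' rect a ∉ 𝓝 (E ζ) := by
  intro hnhds
  obtain ⟨r, hr, hball⟩ := Metric.nhds_basis_closedBall.mem_iff.mp hnhds
  set F := Function.invFunOn E (rect a)
  have hFc : ContinuousOn F (E '' rect a) :=
    continuousOn_invFunOn_image (isCompact_rect a) hE hinj
  have hFmaps : MapsTo F (E '' rect a) (rect a) := (surjOn_image E _).mapsTo_invFunOn
  have hEF : ∀ w ∈ E '' rect a, E (F w) = w := (surjOn_image E _).rightInvOn_invFunOn
  set p : Circle → ℂ := fun u => E ζ + r * u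
  have hp : ∀ u, p u ∈ E '' rect a := fun u => hball (by simp [p, abs_of_pos hr, Circle.norm_coe])
  have hpc : Continuous p := by fun_prop
  have hγc : Continuous fun u => F (p u) := hFc.comp_continuous hpc hp
  have hγ : ∀ u, F (p u) ∈ rect a := fun u => hFmaps (hp u)
  have hγne : ∀ u, F (p u) ≠ ζ := fun u h => by
    have := hEF _ (hp u)
    rw [h] at this
    simp [p, hr.ne'] at this
  set c : ℂ := ⟨a / 2, 1 / 2⟩
  have hc : c ∈ openRect a := ⟨⟨by simp [c, ha], by simp [c, ha]⟩, by norm_num [c], by norm_num [c]⟩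
  -- The loop `F ∘ p` is contracted linearly to the centre `c`. For `s < 1` it lies in the open
  -- rectangle, so it never meets the boundary point `ζ`.
  have hmem : ∀ x : unitInterval × Circle, c + (x.1 : ℝ) * (F (p x.2) - c) ∈ rect a ∧
      c + (x.1 : ℝ) * (F (p x.2) - c) ≠ ζ := by
    rintro ⟨⟨s, hs0, hs1⟩, u⟩
    rcases hs1.lt_or_eq with h | h
    · have := contract_mem_openRect hc (hγ u) ⟨hs0, h⟩
      exact ⟨openRect_subset_rect _ this, fun h' => hζ' (h' ▸ this)⟩
    · simp only [h, ofReal_one, one_mul, add_sub_cancel]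
      exact ⟨hγ u, hγne u⟩
  have hHc : Continuous fun x : unitInterval × Circle =>
      E (c + (x.1 : ℝ) * (F (p x.2) - c)) - E ζ := by
    refine (hE.comp_continuous ?_ fun x => (hmem x).1).sub continuous_const
    exact continuous_const.add ((by fun_prop : Continuous fun x : unitInterval × Circle =>
      (((x.1 : ℝ)) : ℂ)).mul ((hγc.comp continuous_snd).sub continuous_const))
  let H : C(unitInterval × Circle, {z : ℂ // z ≠ 0}) :=
    ⟨fun x => ⟨E (c + (x.1 : ℝ) * (F (p x.2) - c)) - E ζ, fun h =>
      (hmem x).2 (hinj (hmem x).1 hζ (sub_eq_zero.mp h))⟩, hHc.subtype_mk _⟩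
  have hne : E c - E ζ ≠ 0 := fun h =>
    hζ' (hinj (openRect_subset_rect _ hc) hζ (sub_eq_zero.mp h) ▸ hc)
  have H0 : ∀ u, H (0, u) = ⟨exp (ContinuousMap.const Circle (log (E c - E ζ)) u), exp_ne_zero _⟩ := by
    intro u
    apply Subtype.ext
    simp [H, exp_log hne]
  -- The image homotopy avoids `E ζ` and joins a constant to `u ↦ r * u`; lifting it through `exp`
  -- gives a forbidden logarithm.
  refine not_exists_continuous_log_circle r
    ⟨fun u => isCoveringMap_exp.liftHomotopy H (.const _ (log (E c - E ζ))) H0 (1, u),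
      by fun_prop, fun u => ?_⟩
  have := congrArg Subtype.val
    (congrFun (isCoveringMap_exp.liftHomotopy_lifts H (.const _ (log (E c - E ζ))) H0) (1, u))
  simp only [Function.comp_apply] at this
  rw [this]
  simp [H, hEF _ (hp u), p]

/-- The inverse of an injective holomorphic map is holomorphic, provided it is continuous. -/
lemma differentiableOn_of_rightInverse {U : Set ℂ} (hU : IsOpen U) {E F : ℂ → ℂ}
    (hE : DifferentiableOn ℂ E U) (hinj : InjOn E U) {V : Set ℂ} (hV : IsOpen V)
    (hF : ContinuousOn F V) (hmaps : MapsTo F V U) (hEF : ∀ w ∈ V, E (F w) = w) :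
    DifferentiableOn ℂ F V := by
  intro w hw
  have hFw : ContinuousAt F w := hF.continuousAt (hV.mem_nhds hw)
  have han : AnalyticAt ℂ (deriv E) (F w) := (hE.analyticAt (hU.mem_nhds (hmaps hw))).deriv
  -- Zeros of `E'` are isolated, since otherwise `E` would be locally constant. Away from them the
  -- inverse is differentiable, and by continuity the remaining singularity is removable.
  refine (analyticAt_of_differentiable_on_punctured_nhds_of_continuousAt ?_
    hFw).differentiableAt.differentiableWithinAt
  rcases han.eventually_eq_zero_or_eventually_ne_zero with h | h
  · exfalso
    obtain ⟨r, hr, hball⟩ := Metric.mem_nhds_iff.mp (h.and (hU.mem_nhds (hmaps hw)))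
    have hconst : ∀ z ∈ Metric.ball (F w) r, E z = E (F w) := fun z hz =>
      (convex_ball (F w) r).is_const_of_fderivWithin_eq_zero (𝕜 := ℂ)
        (hE.mono fun x hx => (hball hx).2) (fun x hx => by
          rw [fderivWithin_of_isOpen Metric.isOpen_ball hx, ← toSpanSingleton_deriv, (hball hx).1]
          simp) hz (Metric.mem_ball_self hr)
    have hz : F w + (r / 2 : ℝ) ∈ Metric.ball (F w) r := by
      simp [abs_of_pos hr, hr]
    have := hinj (hball hz).2 (hmaps hw) (hconst _ hz)
    simp [hr.ne'] at this
  · have h1 : ∀ᶠ v in 𝓝[≠] w, F v ∈ ({F w}ᶜ : Set ℂ) := by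
      filter_upwards [self_mem_nhdsWithin, mem_nhdsWithin_of_mem_nhds (hV.mem_nhds hw)]
        with v hv hvV h'
      exact hv (by rw [mem_singleton_iff, ← hEF v hvV, ← hEF w hw, mem_singleton_iff.mp h'])
    have h2 : Tendsto F (𝓝[≠] w) (𝓝[≠] (F w)) :=
      tendsto_nhdsWithin_iff.mpr ⟨hFw.mono_left nhdsWithin_le_nhds, h1⟩
    filter_upwards [h2.eventually h, mem_nhdsWithin_of_mem_nhds (hV.mem_nhds hw)] with v hv hvV
    refine (HasDerivAt.of_local_left_inverse (hF.continuousAt (hV.mem_nhds hvV))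
      (hE.differentiableAt (hU.mem_nhds (hmaps hvV))).hasDerivAt hv ?_).differentiableAt
    filter_upwards [hV.mem_nhds hvV] with y hy using hEF y hy

/-! ### The inverse embedding on a rectangle contained in the shape -/

namespace IsConformalEmbedding

variable {R T L : ℝ} {E : ℂ → ℂ}

lemma R_pos (h : IsConformalEmbedding R T E) : 0 < R := h.pos.trans h.lt

lemma isOpen_image_openRect (h : IsConformalEmbedding R T E) : IsOpen (E '' openRect R) := by
  rcases (h.holo.analyticOnNhd (isOpen_openRect R)).is_constant_or_isOpen
    (convex_openRect R).isPreconnected with ⟨w, hw⟩ | ho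
  · exfalso
    have hR := h.R_pos
    have h1 : (⟨R / 2, 1 / 2⟩ : ℂ) ∈ openRect R :=
      ⟨⟨by simp [hR], by simp [hR]⟩, by norm_num, by norm_num⟩
    have h2 : (⟨R / 2, 1 / 3⟩ : ℂ) ∈ openRect R :=
      ⟨⟨by simp [hR], by simp [hR]⟩, by norm_num, by norm_num⟩
    have := h.injOn (openRect_subset_rect _ h1) (openRect_subset_rect _ h2)
      ((hw _ h1).trans (hw _ h2).symm)
    norm_num at this
  · exact ho _ subset_rfl (isOpen_openRect R)

lemma image_openRect_subset (h : IsConformalEmbedding R T E) : E '' openRect R ⊆ openRect T := by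
  rw [← interior_rect T]
  refine interior_maximal ?_ h.isOpen_image_openRect
  rintro _ ⟨z, hz, rfl⟩
  exact h.mapsTo (openRect_subset_rect _ hz)

lemma openRect_subset_image (h : IsConformalEmbedding R T E) (hL : rect L ⊆ E '' rect R) :
    openRect L ⊆ E '' openRect R := by
  intro w hw
  obtain ⟨z, hz, rfl⟩ := hL (openRect_subset_rect _ hw)
  by_contra hcon
  refine image_notMem_nhds_of_boundary h.R_pos h.continuousOn h.injOn hz
    (fun hz' => hcon ⟨z, hz', rfl⟩) ?_
  exact mem_of_superset ((isOpen_openRect L).mem_nhds hw) ((openRect_subset_rect _).trans hL)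

lemma right_side_re (h : IsConformalEmbedding R T E) {z : ℂ} (hz : z ∈ vertSide R) :
    (E z).re = T := by
  have : E z ∈ segment ℝ (E R) (E (R + I)) := h.right_side ▸ mem_image_of_mem E hz
  obtain ⟨a, b, ha, hb, hab, he⟩ := this
  rw [← he]
  simp only [add_re, real_smul, mul_re, ofReal_re, ofReal_im, zero_mul, sub_zero, h.re_p₁, h.re_p₂]
  rw [← add_mul, hab, one_mul]

/-- Points of the horizontal sides of `rect T` left of the vertical line `Re = T` and right of the
imaginary axis can only come from the horizontal sides of `rect R`. -/
lemma im_preimage (h : IsConformalEmbedding R T E) {z : ℂ} (hz : z ∈ rect R)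
    (h0 : (E z).re ∈ Ioo 0 T) (h1 : (E z).im = 0 ∨ (E z).im = 1) : z.im = 0 ∨ z.im = 1 := by
  by_contra! hcon
  have him : z.im ∈ Ioo (0 : ℝ) 1 :=
    ⟨hz.2.1.lt_of_ne' hcon.1, hz.2.2.lt_of_ne hcon.2⟩
  rcases hz.1.1.eq_or_lt with hre | hre
  · have : E z ∈ vertSide 0 := h.left_side ▸ mem_image_of_mem E ⟨hre.symm, hz.2⟩
    exact h0.1.ne' this.1
  rcases hz.1.2.eq_or_lt with hre' | hre'
  · exact h0.2.ne (h.right_side_re ⟨hre', hz.2⟩)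
  have := (h.image_openRect_subset ⟨z, ⟨⟨hre, hre'⟩, him⟩, rfl⟩).2
  rcases h1 with h1 | h1 <;> rw [h1] at this <;> simp at this

/-- A continuous inverse of `E` maps the horizontal line at height `k` to itself, if this is true of
the point on the imaginary axis. -/
lemma im_inverse_eq (h : IsConformalEmbedding R T E) (hLT : L < T) {F : ℂ → ℂ}
    (hF : ContinuousOn F (rect L)) (hFm : MapsTo F (rect L) (rect R))
    (hEF : ∀ w ∈ rect L, E (F w) = w) {k : ℝ} (hk : k = 0 ∨ k = 1)
    (hFk : (F (k * I)).im = k) {w : ℂ} (hw : w ∈ rect L) (hwk : w.im = k) : (F w).im = k := by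
  have hk' : k ∈ Icc (0 : ℝ) 1 := by rcases hk with rfl | rfl <;> simp
  have hmem : ∀ x ∈ Icc 0 L, (x + k * I : ℂ) ∈ rect L := fun x hx =>
    ⟨by simpa using hx, by simpa using hk'⟩
  have hc : ContinuousOn (fun x : ℝ => (F (x + k * I)).im) (Icc 0 L) :=
    continuous_im.comp_continuousOn (hF.comp (by fun_prop) hmem)
  have hval : ∀ x ∈ Icc 0 L, (F (x + k * I)).im = 0 ∨ (F (x + k * I)).im = 1 := by
    intro x hx
    rcases hx.1.eq_or_lt with rfl | hx0
    · rw [ofReal_zero, zero_add, hFk]; exact hk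
    · refine h.im_preimage (hFm (hmem x hx)) ?_ ?_ <;> rw [hEF _ (hmem x hx)]
      · simpa using ⟨hx0, hx.2.trans_lt hLT⟩
      · simpa using hk
  have hweq : w = w.re + k * I := by rw [← hwk, re_add_im]
  by_contra hne
  have hL : 0 ≤ L := hw.1.1.trans hw.1.2
  have himg : IsPreconnected ((fun x : ℝ => (F (x + k * I)).im) '' Icc 0 L) :=
    isPreconnected_Icc.image _ hc
  have h0m : k ∈ (fun x : ℝ => (F (x + k * I)).im) '' Icc 0 L :=
    ⟨0, ⟨le_rfl, hL⟩, by simpa using hFk⟩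
  have h1m : (F w).im ∈ (fun x : ℝ => (F (x + k * I)).im) '' Icc 0 L :=
    ⟨w.re, hw.1, by rw [hweq]; simp⟩
  have hw01 : (F w).im = 0 ∨ (F w).im = 1 := by rw [hweq]; exact hval _ hw.1
  -- `Im F` along the line takes only the values `0` and `1`; a switch between them would force the
  -- value `1/2`.
  have hhalf : (1 / 2 : ℝ) ∈ (fun x : ℝ => (F (x + k * I)).im) '' Icc 0 L := by
    rcases hk with rfl | rfl <;> rcases hw01 with h' | h'
    · exact absurd h' hne
    · exact himg.Icc_subset h0m h1m (by rw [h']; norm_num)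
    · exact himg.Icc_subset h1m h0m (by rw [h']; norm_num)
    · exact absurd h' hne
  obtain ⟨x, hx, hx'⟩ := hhalf
  beta_reduce at hx'
  rcases hval x hx with h' | h' <;> rw [h'] at hx' <;> norm_num at hx'

/-- The inverse of a conformal embedding on a rectangle contained in the shape. -/
theorem exists_inverse (h : IsConformalEmbedding R T E) (hLT : L < T)
    (hL : rect L ⊆ E '' rect R) :
    ∃ F : ℂ → ℂ, ContinuousOn F (rect L) ∧ DifferentiableOn ℂ F (openRect L) ∧
      MapsTo F (rect L) (rect R) ∧ (∀ z ∈ rect R, F (E z) = z) ∧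
      (∀ w ∈ rect L, w.im = 0 → (F w).im = 0) ∧ (∀ w ∈ rect L, w.im = 1 → (F w).im = 1) ∧
      (∀ w ∈ rect L, w.re = 0 → (F w).re = 0) := by
  set F := Function.invFunOn E (rect R)
  have hFE : ∀ z ∈ rect R, F (E z) = z := fun z hz => h.injOn.leftInvOn_invFunOn hz
  have hFc : ContinuousOn F (E '' rect R) :=
    continuousOn_invFunOn_image (isCompact_rect R) h.continuousOn h.injOn
  have hFm : MapsTo F (E '' rect R) (rect R) := (surjOn_image E _).mapsTo_invFunOn
  have hEF : ∀ w ∈ E '' rect R, E (F w) = w := (surjOn_image E _).rightInvOn_invFunOn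
  have hR := h.R_pos
  have h0 : (0 : ℂ) ∈ rect R := ⟨by simp [hR.le], by simp⟩
  have h1 : I ∈ rect R := ⟨by simp [hR.le], by simp⟩
  have hF0 : F 0 = 0 := by simpa [h.map_zero] using hFE 0 h0
  have hFI : F I = I := by simpa [h.map_I] using hFE I h1
  have hopen : openRect L ⊆ E '' openRect R := h.openRect_subset_image hL
  refine ⟨F, hFc.mono hL, ?_, hFm.mono_left hL, hFE, ?_, ?_, ?_⟩
  · refine differentiableOn_of_rightInverse (isOpen_openRect R) h.holo
      (h.injOn.mono (openRect_subset_rect R)) (isOpen_openRect L)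
      (hFc.mono ((openRect_subset_rect L).trans hL)) (fun w hw => ?_)
      fun w hw => hEF w (hL (openRect_subset_rect L hw))
    obtain ⟨z, hz, rfl⟩ := hopen hw
    rwa [hFE z (openRect_subset_rect R hz)]
  · exact fun w hw hw0 => h.im_inverse_eq hLT (hFc.mono hL) (hFm.mono_left hL)
      (fun w hw => hEF w (hL hw)) (.inl rfl) (by simp [hF0]) hw hw0
  · exact fun w hw hw0 => h.im_inverse_eq hLT (hFc.mono hL) (hFm.mono_left hL)
      (fun w hw => hEF w (hL hw)) (.inr rfl) (by simp [hFI]) hw hw0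
  · intro w hw hw0
    have : w ∈ E '' vertSide 0 := by
      rw [h.left_side]; exact ⟨hw0, hw.2⟩
    obtain ⟨z, hz, rfl⟩ := this
    rw [hFE z ⟨by rw [hz.1]; exact ⟨le_rfl, hR.le⟩, hz.2⟩, hz.1]

end IsConformalEmbedding

/-! ### Fourier expansion of holomorphic functions on a rectangle -/

/-- Pointwise Fourier expansion on `[0,1]` of a function whose real part is expanded in cosines and
whose imaginary part is expanded in sines. -/
lemma hasSum_fourier_half {D : ℝ → ℂ} (hD : ContinuousOn D (Icc 0 1)) (h0 : (D 0).im = 0)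
    (h1 : (D 1).im = 0) {c : ℤ → ℝ}
    (hc : ∀ n : ℤ, (∫ y in (0 : ℝ)..1, D y * exp (-(Real.pi * n * y * I))).re = c n)
    (hs : Summable c) {y : ℝ} (hy : y ∈ Icc (0 : ℝ) 1) :
    HasSum (fun n : ℤ => (c n : ℂ) * exp (Real.pi * n * y * I)) (D y) := by
  -- Extension by conjugate reflection with period 2, continuous because `D` is real at `0` and `1`.
  -- Its `n`-th Fourier coefficient is the average of the integral in `hc` and its conjugate, hence
  -- the real number `c n`.
  set Φ : ℝ → ℂ := fun y => if y ≤ 0 then conj (D (-y)) else D y with hΦ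
  have : Fact ((0 : ℝ) < 2) := ⟨two_pos⟩
  have hΦn : ∀ y ∈ Icc (0 : ℝ) 1, Φ (-y) = conj (D y) := by
    intro y hy
    simp [hΦ, hy.1]
  have hΦp : ∀ y ∈ Icc (0 : ℝ) 1, Φ y = D y := by
    intro y hy
    rcases hy.1.eq_or_lt with rfl | h
    · simp [hΦ, conj_eq_iff_im.mpr h0]
    · simp [hΦ, not_le.mpr h]
  have hper : Φ (-1) = Φ (-1 + 2) := by
    rw [hΦn 1 (by simp)]
    norm_num
    rw [hΦp 1 (by simp), conj_eq_iff_im.mpr h1]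
  have hDn : ContinuousOn (fun y => conj (D (-y))) (Icc (-1) 0) :=
    continuous_conj.comp_continuousOn (hD.comp continuous_neg.continuousOn
      fun x hx => ⟨by linarith [hx.2], by linarith [hx.1]⟩)
  have hcont : ContinuousOn Φ (Icc (-1) (-1 + 2)) := by
    refine ContinuousOn.if ?_ ?_ ?_
    · rintro a ⟨-, ha⟩
      have : a = 0 := by
        rw [show {a : ℝ | a ≤ 0} = Iic 0 from rfl, frontier_Iic] at ha
        exact ha
      simp [this, conj_eq_iff_im.mpr h0]
    · refine hDn.mono ?_
      rintro a ⟨ha, ha'⟩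
      exact ⟨ha.1, by rwa [show {a : ℝ | a ≤ 0} = Iic 0 from rfl, closure_Iic] at ha'⟩
    · refine hD.mono ?_
      rintro a ⟨ha, ha'⟩
      have : a ∈ Ici (0 : ℝ) := by
        simp only [not_le] at ha'
        rwa [show {a : ℝ | 0 < a} = Ioi 0 from rfl, closure_Ioi] at ha'
      exact ⟨this, by linarith [ha.2]⟩
  let f : C(AddCircle (2 : ℝ), ℂ) :=
    ⟨AddCircle.liftIoc 2 (-1) Φ, AddCircle.liftIoc_continuous hper hcont⟩
  have hcoef : ∀ n, fourierCoeff f n = c n := by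
    intro n
    change fourierCoeff (AddCircle.liftIoc 2 (-1) Φ) n = c n
    rw [fourierCoeff_liftIoc_eq, fourierCoeffOn_eq_integral]
    have e1 : ∀ x : ℝ, (fourier (-n) (x : AddCircle ((-1 : ℝ) + 2 - -1)) : ℂ)
        = exp (-(Real.pi * n * x * I)) := by
      intro x
      rw [fourier_coe_apply]
      congr 1
      push_cast
      ring
    simp only [e1, smul_eq_mul]
    have hsplit : (∫ x in (-1 : ℝ)..(-1 + 2), exp (-(Real.pi * n * x * I)) * Φ x)
        = (∫ x in (-1 : ℝ)..0, exp (-(Real.pi * n * x * I)) * Φ x)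
          + ∫ x in (0 : ℝ)..1, exp (-(Real.pi * n * x * I)) * Φ x := by
      have hi : ∀ a b : ℝ, a ∈ Icc (-1 : ℝ) (-1 + 2) → b ∈ Icc (-1 : ℝ) (-1 + 2) →
          IntervalIntegrable (fun x : ℝ => exp (-(Real.pi * n * x * I)) * Φ x) volume a b := by
        intro a b ha hb
        apply ContinuousOn.intervalIntegrable
        exact ContinuousOn.mul (by fun_prop) (hcont.mono (uIcc_subset_Icc ha hb))
      rw [intervalIntegral.integral_add_adjacent_intervals (hi _ _ (by norm_num) (by norm_num))
        (hi _ _ (by norm_num) (by norm_num))]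
      norm_num
    have hneg : (∫ x in (-1 : ℝ)..0, exp (-(Real.pi * n * x * I)) * Φ x)
        = conj (∫ y in (0 : ℝ)..1, D y * exp (-(Real.pi * n * y * I))) := by
      rw [← intervalIntegral.intervalIntegral_conj]
      have := intervalIntegral.integral_comp_neg (a := 0) (b := 1)
        (fun x : ℝ => exp (-(Real.pi * n * x * I)) * Φ x)
      rw [neg_zero] at this
      rw [← this]
      refine intervalIntegral.integral_congr fun y hy => ?_
      rw [uIcc_of_le zero_le_one] at hy
      simp only [hΦn y hy, map_mul, ← exp_conj, map_neg, conj_ofReal, conj_I, map_intCast]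
      push_cast
      rw [mul_comm]
      congr 2
      ring
    have hpos : (∫ x in (0 : ℝ)..1, exp (-(Real.pi * n * x * I)) * Φ x)
        = ∫ y in (0 : ℝ)..1, D y * exp (-(Real.pi * n * y * I)) := by
      refine intervalIntegral.integral_congr fun y hy => ?_
      rw [uIcc_of_le zero_le_one] at hy
      simp only [hΦp y hy, mul_comm]
    rw [hsplit, hneg, hpos, add_comm (conj _), add_conj, hc n]
    norm_num
    ring
  have hsum : Summable (fourierCoeff f) := by
    have : fourierCoeff f = fun n => (c n : ℂ) := funext hcoef
    rw [this]
    exact (ofRealCLM.summable hs)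
  have := has_pointwise_sum_fourier_series_of_summable hsum (y : AddCircle (2 : ℝ))
  have hfy : f (y : AddCircle (2 : ℝ)) = D y := by
    change AddCircle.liftIoc 2 (-1) Φ y = D y
    rw [AddCircle.liftIoc_coe_apply ⟨by linarith [hy.1], by linarith [hy.2]⟩, hΦp y hy]
  rw [hfy] at this
  refine this.congr_fun ?_
  intro n
  rw [hcoef, fourier_coe_apply, smul_eq_mul]
  congr 2
  push_cast
  ring

/-- Expansion in hyperbolic sines of a holomorphic function on a rectangle that is real on the
horizontal sides and imaginary on the left side. -/
theorem exists_hasSum_sinh {L : ℝ} (hL : 0 < L) {G : ℂ → ℂ} (hGc : ContinuousOn G (rect L))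
    (hGd : DifferentiableOn ℂ G (openRect L)) (hbot : ∀ w ∈ rect L, w.im = 0 → (G w).im = 0)
    (htop : ∀ w ∈ rect L, w.im = 1 → (G w).im = 0) (hleft : ∀ w ∈ rect L, w.re = 0 → (G w).re = 0)
    (hbd : ∀ w ∈ rect L, |(G w).im| ≤ 1) :
    ∃ a : ℕ → ℝ, (∀ n, |a n| ≤ 4 * Real.exp (-(Real.pi * (n + 1) * L))) ∧
      ∀ w ∈ rect L, w.re < L →
        HasSum (fun n : ℕ => (a n : ℂ) * sinh (Real.pi * (n + 1) * w)) (G w) := by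
  have hmem : ∀ x ∈ Icc 0 L, ∀ y ∈ Icc (0 : ℝ) 1, (x + y * I : ℂ) ∈ rect L := fun x hx y hy =>
    ⟨by simpa using hx, by simpa using hy⟩
  have hcont : ∀ x ∈ Icc 0 L, ContinuousOn (fun y : ℝ => G (x + y * I)) (Icc 0 1) := fun x hx =>
    hGc.comp (by fun_prop) (hmem x hx)
  -- the real part of the integral over a vertical segment does not depend on the segment
  have hJ : ∀ n : ℤ, ∀ x ∈ Icc 0 L,
      (∫ y in (0 : ℝ)..1, G (x + y * I) * exp (-(Real.pi * n * (x + y * I)))).re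
        = (∫ y in (0 : ℝ)..1, G (y * I) * exp (-(Real.pi * n * (y * I)))).re := by
    intro n x hx
    -- On both horizontal sides `G` and `exp (-πnz)` are real, so these sides drop out of the
    -- imaginary part of Cauchy's theorem, and only the real parts of the vertical integrals remain.
    have hreal : ∀ k : ℝ, (k = 0 ∨ k = 1) → (∫ t in (0 : ℝ)..x,
        G (t + k * I) * exp (-(Real.pi * n * (t + k * I)))).im = 0 := by
      intro k hk
      have : ∀ t ∈ uIcc 0 x, G (t + k * I) * exp (-(Real.pi * n * (t + k * I)))
          = ((G (t + k * I) * exp (-(Real.pi * n * (t + k * I)))).re : ℂ) := by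
        intro t ht
        rw [uIcc_of_le hx.1] at ht
        have ht' : t ∈ Icc 0 L := ⟨ht.1, ht.2.trans hx.2⟩
        have hG : (G (t + k * I)).im = 0 := by
          rcases hk with rfl | rfl
          · exact hbot _ (hmem t ht' 0 (by simp)) (by simp)
          · exact htop _ (hmem t ht' 1 (by simp)) (by simp)
        have he : (exp (-(Real.pi * n * (t + k * I)))).im = 0 := by
          rw [exp_im]
          have : (-(Real.pi * n * (t + k * I) : ℂ)).im = -(n * k * Real.pi) := by
            simp; ring
          rw [this, Real.sin_neg]
          rcases hk with rfl | rfl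
          · simp
          · simp [Real.sin_int_mul_pi]
        apply Complex.ext
        · simp
        · simp [mul_im, hG, he]
      rw [intervalIntegral.integral_congr this, intervalIntegral.integral_ofReal, ofReal_im]
    have hsub1 : uIcc (0 : ℂ).re (x + I : ℂ).re ×ℂ uIcc (0 : ℂ).im (x + I : ℂ).im ⊆ rect L := by
      intro z hz
      simp only [zero_re, add_re, ofReal_re, I_re, add_zero, zero_im, add_im, ofReal_im, I_im,
        zero_add, uIcc_of_le hx.1, uIcc_of_le zero_le_one] at hz
      exact ⟨⟨hz.1.1, hz.1.2.trans hx.2⟩, hz.2⟩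
    have hsub2 : Ioo (min (0 : ℂ).re (x + I : ℂ).re) (max (0 : ℂ).re (x + I : ℂ).re) ×ℂ
        Ioo (min (0 : ℂ).im (x + I : ℂ).im) (max (0 : ℂ).im (x + I : ℂ).im) ⊆ openRect L := by
      intro z hz
      simp only [zero_re, add_re, ofReal_re, I_re, add_zero, zero_im, add_im, ofReal_im, I_im,
        zero_add, min_eq_left hx.1, max_eq_right hx.1, min_eq_left zero_le_one,
        max_eq_right zero_le_one] at hz
      exact ⟨⟨hz.1.1, hz.1.2.trans_le hx.2⟩, hz.2⟩
    have := integral_boundary_rect_eq_zero_of_continuousOn_of_differentiableOn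
      (fun z => G z * exp (-(Real.pi * n * z))) 0 (x + I)
      ((hGc.mono hsub1).mul (by fun_prop)) ((hGd.mono hsub2).mul (by fun_prop))
    have him := congrArg im this
    simp only [zero_re, add_re, ofReal_re, I_re, add_zero, zero_im, add_im, ofReal_im, I_im,
        zero_add, smul_eq_mul, sub_im, I_mul_im, ofReal_zero] at him
    have r0 := hreal 0 (.inl rfl)
    have r1 := hreal 1 (.inr rfl)
    simp only [ofReal_zero, zero_mul, add_zero] at r0 him
    rw [r0, r1] at him
    linarith
  set s : ℤ → ℝ := fun n =>
    (∫ y in (0 : ℝ)..1, G (y * I) * exp (-(Real.pi * n * (y * I)))).re with hs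
  -- `G` is imaginary on the left side. Oddness of `s` is what later pairs exponentials into
  -- hyperbolic sines and removes the constant term.
  have hodd : ∀ n, s (-n) = -s n := by
    intro n
    have : (∫ y in (0 : ℝ)..1, G (y * I) * exp (-(Real.pi * (-n : ℤ) * (y * I))))
        = -conj (∫ y in (0 : ℝ)..1, G (y * I) * exp (-(Real.pi * n * (y * I)))) := by
      rw [← intervalIntegral.intervalIntegral_conj, ← intervalIntegral.integral_neg]
      refine intervalIntegral.integral_congr fun y hy => ?_
      rw [uIcc_of_le zero_le_one] at hy
      have hre : (G (y * I)).re = 0 := by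
        have := hleft _ (hmem 0 ⟨le_rfl, hL.le⟩ y hy) (by simp)
        simpa using this
      have hG : conj (G (y * I)) = -G (y * I) := by
        apply Complex.ext <;> simp [hre]
      simp only [map_mul, ← exp_conj, map_neg, conj_ofReal, conj_I, map_intCast, hG]
      push_cast
      rw [neg_mul, neg_neg]
      congr 2
      ring
    simp only [hs, this, neg_re, conj_re]
  have hcoef : ∀ n : ℤ, ∀ x ∈ Icc 0 L,
      (∫ y in (0 : ℝ)..1, G (x + y * I) * exp (-(Real.pi * n * y * I))).re
        = s n * Real.exp (Real.pi * n * x) := by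
    intro n x hx
    have h1 := hJ n x hx
    have h2 : (∫ y in (0 : ℝ)..1, G (x + y * I) * exp (-(Real.pi * n * (x + y * I))))
        = (Real.exp (-(Real.pi * n * x)) : ℝ) *
          ∫ y in (0 : ℝ)..1, G (x + y * I) * exp (-(Real.pi * n * y * I)) := by
      rw [← intervalIntegral.integral_const_mul]
      refine intervalIntegral.integral_congr fun y _ => ?_
      rw [mul_left_comm, ofReal_exp, ← exp_add]
      congr 2
      push_cast
      ring
    rw [h2, re_ofReal_mul] at h1
    simp only [hs]
    rw [← h1, mul_right_comm, ← Real.exp_add]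
    simp
  have hint : ∀ n : ℤ, ∀ x ∈ Icc 0 L, IntervalIntegrable
      (fun y : ℝ => G (x + y * I) * exp (-(Real.pi * n * y * I))) volume 0 1 := by
    intro n x hx
    apply ContinuousOn.intervalIntegrable
    rw [uIcc_of_le zero_le_one]
    exact (hcont x hx).mul (by fun_prop)
  have hbound : ∀ n : ℕ, |s n| ≤ 2 * Real.exp (-(Real.pi * n * L)) := by
    intro n
    have hLm : L ∈ Icc 0 L := ⟨hL.le, le_rfl⟩
    have e1 := hcoef n L hLm
    have e2 := hcoef (-n) L hLm
    rw [hodd] at e2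
    -- Subtracting the coefficients of index `n` and `-n` at `x = L` turns the integrand into `2 Im
    -- G · sin (πny)`, so no bound on `Re G` is needed.
    have e3 : s n * (Real.exp (Real.pi * n * L) + Real.exp (-(Real.pi * n * L)))
        = (∫ y in (0 : ℝ)..1, (G (L + y * I) * exp (-(Real.pi * (n : ℤ) * y * I))
          - G (L + y * I) * exp (-(Real.pi * (-n : ℤ) * y * I)))).re := by
      rw [intervalIntegral.integral_sub (hint n L hLm) (hint (-n) L hLm), sub_re, e1, e2]
      push_cast
      rw [mul_add, neg_mul, sub_neg_eq_add]
      congr 3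
      ring
    have e4 : |s n * (Real.exp (Real.pi * n * L) + Real.exp (-(Real.pi * n * L)))| ≤ 2 := by
      rw [e3, ← reCLM_apply, ← reCLM.intervalIntegral_comp_comm
        ((hint n L hLm).sub (hint (-n) L hLm)), ← Real.norm_eq_abs]
      refine (intervalIntegral.norm_integral_le_of_norm_le_const (C := 2) fun y hy => ?_).trans
        (by simp)
      rw [uIoc_of_le zero_le_one] at hy
      have hb := hbd _ (hmem L hLm y ⟨hy.1.le, hy.2⟩)
      have hval : (G (L + y * I) * exp (-(Real.pi * (n : ℤ) * y * I))
          - G (L + y * I) * exp (-(Real.pi * (-n : ℤ) * y * I))).re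
          = 2 * ((G (L + y * I)).im * Real.sin (Real.pi * n * y)) := by
        have f1 : exp (-(Real.pi * (n : ℤ) * y * I)) - exp (-(Real.pi * (-n : ℤ) * y * I))
            = -(2 * Real.sin (Real.pi * n * y) : ℝ) * I := by
          have g1 : (-(Real.pi * (n : ℤ) * y * I) : ℂ) = (-(Real.pi * n * y) : ℝ) * I := by
            push_cast; ring
          have g2 : (-(Real.pi * (-n : ℤ) * y * I) : ℂ) = ((Real.pi * n * y : ℝ) : ℂ) * I := by
            push_cast; ring
          rw [g1, g2, exp_mul_I, exp_mul_I, ← ofReal_cos, ← ofReal_cos, ← ofReal_sin, ← ofReal_sin,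
            Real.cos_neg, Real.sin_neg]
          push_cast
          ring
        rw [← mul_sub, f1]
        simp only [mul_re, mul_im, neg_re, neg_im, ofReal_re, ofReal_im, I_re, I_im]
        ring
      rw [reCLM_apply, hval, Real.norm_eq_abs, abs_mul, abs_mul, abs_two]
      have := Real.abs_sin_le_one (Real.pi * n * y)
      nlinarith [abs_nonneg (Real.sin (Real.pi * n * y)), abs_nonneg (G (L + y * I)).im]
    rw [abs_mul, abs_of_pos (add_pos (Real.exp_pos _) (Real.exp_pos _))] at e4
    have e5 : |s n| * Real.exp (Real.pi * n * L) ≤ 2 := by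
      nlinarith [abs_nonneg (s n), Real.exp_pos (-(Real.pi * n * L))]
    rw [Real.exp_neg, ← div_eq_mul_inv, le_div_iff₀ (Real.exp_pos _)]
    exact e5
  refine ⟨fun n => 2 * s (n + 1), fun n => ?_, fun w hw hwL => ?_⟩
  · have := hbound (n + 1)
    push_cast at this
    rw [abs_mul, abs_two]
    linarith
  · have hx : w.re ∈ Icc 0 L := hw.1
    -- The terms decay like `exp (-πn(L - Re w))`; this is why the side `Re w = L` is excluded.
    have hgeo : Summable fun n : ℕ => 2 * Real.exp (-(Real.pi * (L - w.re))) ^ n :=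
      (summable_geometric_of_lt_one (Real.exp_pos _).le (Real.exp_lt_one_iff.mpr
        (neg_neg_of_pos (mul_pos Real.pi_pos (sub_pos.mpr hwL))))).mul_left 2
    have hsummable : Summable fun n : ℤ => s n * Real.exp (Real.pi * n * w.re) := by
      apply Summable.of_nat_of_neg
      · refine Summable.of_norm_bounded hgeo fun n => ?_
        rw [norm_mul, Real.norm_eq_abs, Real.norm_of_nonneg (Real.exp_pos _).le, ← Real.exp_nat_mul]
        refine (mul_le_mul_of_nonneg_right (hbound n) (Real.exp_pos _).le).trans ?_
        rw [mul_assoc, ← Real.exp_add]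
        gcongr
        push_cast
        apply le_of_eq
        ring
      · refine Summable.of_norm_bounded hgeo fun n => ?_
        rw [hodd, norm_mul, norm_neg, Real.norm_eq_abs, Real.norm_of_nonneg (Real.exp_pos _).le,
          ← Real.exp_nat_mul]
        refine (mul_le_mul_of_nonneg_right (hbound n) (Real.exp_pos _).le).trans ?_
        rw [mul_assoc, ← Real.exp_add]
        gcongr
        push_cast
        have : 0 ≤ Real.pi * n * w.re := by have := hx.1; positivity
        nlinarith
    have h0 : s 0 = 0 := by
      have := hodd 0
      rw [neg_zero] at this
      linarith
    have hsum := hasSum_fourier_half (hcont _ hx)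
      (hbot _ (hmem _ hx 0 (by simp)) (by simp)) (htop _ (hmem _ hx 1 (by simp)) (by simp))
      (fun n => hcoef n _ hx) hsummable hw.2
    rw [re_add_im] at hsum
    have hsum' := hsum.nat_add_neg
    rw [← hasSum_nat_add_iff' 1] at hsum'
    simp only [Finset.range_one, Finset.sum_singleton] at hsum'
    have hz : G w + (↑(s 0 * Real.exp (Real.pi * (0 : ℤ) * w.re)) : ℂ)
        * exp (Real.pi * (0 : ℤ) * w.im * I)
        - ((↑(s ((0 : ℕ) : ℤ) * Real.exp (Real.pi * ((0 : ℕ) : ℤ) * w.re)) : ℂ)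
          * exp (Real.pi * ((0 : ℕ) : ℤ) * w.im * I)
          + (↑(s (-((0 : ℕ) : ℤ)) * Real.exp (Real.pi * (-((0 : ℕ) : ℤ) : ℤ) * w.re)) : ℂ)
          * exp (Real.pi * (-((0 : ℕ) : ℤ) : ℤ) * w.im * I)) = G w := by
      simp [h0]
    rw [hz] at hsum'
    refine hsum'.congr_fun fun n => ?_
    rw [hodd]
    have e1 : ∀ m : ℤ, ((Real.exp (Real.pi * m * w.re) : ℝ) : ℂ) * exp (Real.pi * m * w.im * I)
        = exp (Real.pi * m * w) := by
      intro m
      rw [ofReal_exp, ← exp_add]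
      congr 1
      conv_rhs => rw [← re_add_im w]
      push_cast
      ring
    rw [ofReal_mul (s _), ofReal_mul (-s _), mul_assoc (s (n + 1 : ℕ) : ℂ),
      mul_assoc ((-s (n + 1 : ℕ) : ℝ) : ℂ), e1, e1,
      sinh]
    push_cast
    ring_nf

/-! ### Perturbations of the identity -/

section Perturbation

variable {h : ℂ → ℂ} {c : NNReal}

lemma approximatesLinearOn_id_add (hh : LipschitzWith c h) :
    ApproximatesLinearOn (fun z => z + h z)
      ((ContinuousLinearEquiv.refl ℝ ℂ : ℂ ≃L[ℝ] ℂ) : ℂ →L[ℝ] ℂ) univ c := by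
  intro x _ y _
  have := hh.dist_le_mul x y
  rw [dist_eq_norm, dist_eq_norm] at this
  change ‖x + h x - (y + h y) - (x - y)‖ ≤ c * ‖x - y‖
  rwa [show x + h x - (y + h y) - (x - y) = h x - h y by ring]

/-- The homeomorphism `z ↦ z + h z` of the plane for a contraction `h`. -/
def perturbHomeo (hh : LipschitzWith c h) (hc : c < 1) : ℂ ≃ₜ ℂ :=
  (approximatesLinearOn_id_add hh).toHomeomorph _ (.inr (by simpa using hc))

/-- The increment is `(w - z)(1 + u)` with `|u| < 1`. The factor `1 + u` stays in the slit plane, so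
its principal argument is continuous and returns to its initial value; all the winding comes from `w
- z`. -/
lemma orientationPreservingOn_id_add (hh : LipschitzWith c h) (hc : c < 1) (Ω : Set ℂ) :
    OrientationPreservingOn (fun z => z + h z) Ω := by
  intro z _ r hr _
  set u : ℝ → ℂ := fun t => (h (circleMap z r t) - h z) / (circleMap 0 r t)
  have hne : ∀ t, circleMap 0 r t ≠ 0 := fun t => by simp [circleMap, hr.ne']
  have hcont : Continuous u := by
    refine ((hh.continuous.comp (continuous_circleMap z r)).sub continuous_const).div
      (continuous_circleMap 0 r) hne
  have hu : ∀ t, ‖u t‖ < 1 := by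
    intro t
    have h1 := hh.dist_le_mul (circleMap z r t) z
    rw [dist_eq_norm, dist_eq_norm] at h1
    have h2 : circleMap z r t - z = circleMap 0 r t := by simp [circleMap]
    rw [h2] at h1
    rw [norm_div, div_lt_one (norm_pos_iff.mpr (hne t))]
    refine h1.trans_lt ?_
    have : (c : ℝ) < 1 := hc
    nlinarith [norm_pos_iff.mpr (hne t)]
  have hslit : ∀ t, 1 + u t ∈ slitPlane := fun t => mem_slitPlane_of_norm_lt_one (hu t)
  refine ⟨fun t => t + arg (1 + u t), ?_, ?_, ?_⟩
  · refine continuous_id.add (continuous_iff_continuousAt.mpr fun t => ?_)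
    exact (continuousAt_arg (hslit t)).comp (f := fun t => 1 + u t)
      (continuous_const.add hcont).continuousAt
  · intro t
    have heq : circleMap z r t + h (circleMap z r t) - (z + h z)
        = circleMap 0 r t * (1 + u t) := by
      rw [mul_add, mul_div_cancel₀ _ (hne t)]
      simp [circleMap]
      ring
    simp only [heq]
    rw [norm_mul, norm_circleMap_zero, abs_of_pos hr]
    push_cast
    rw [add_mul, exp_add]
    nth_rewrite 1 [← norm_mul_exp_arg_mul_I (1 + u t)]
    rw [circleMap_zero]
    ring
  · have : u (2 * Real.pi) = u 0 := by
      simp [u, circleMap]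
    simp only [this]
    simp
    ring

end Perturbation

/-! ### Weak derivatives of differentiable functions -/

/-- Integration by parts against a compactly supported test function; the bound on the derivative
supplies local integrability. -/
lemma isWeakWirtinger_of_differentiable {f : ℂ → ℂ} (hf : Differentiable ℝ f) {B : ℝ}
    (hB : ∀ z, ‖fderiv ℝ f z‖ ≤ B) (Ω : Set ℂ) :
    IsWeakWirtinger f Ω (wirtinger f) (wirtingerBar f) := by
  have hmeas : ∀ v, Measurable fun z => fderiv ℝ f z v := fun v => measurable_fderiv_apply_const ℝ f v
  have hloc : ∀ v, LocallyIntegrable (fun z => fderiv ℝ f z v) := by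
    intro v
    refine (locallyIntegrable_const (B * ‖v‖)).mono (hmeas v).aestronglyMeasurable ?_
    filter_upwards with z
    exact ((fderiv ℝ f z).le_of_opNorm_le (hB z) v).trans (le_abs_self _)
  have hint : ∀ g : ℂ → ℂ, LocallyIntegrable g → ∀ φ : ℂ → ℂ, Continuous φ → HasCompactSupport φ →
      Integrable fun z => g z * φ z := by
    intro g hg φ hφ hφc
    simpa [mul_comm] using hg.integrable_smul_left_of_hasCompactSupport hφ hφc
  have hparts : ∀ φ : ℂ → ℂ, ContDiff ℝ ∞ φ → HasCompactSupport φ → ∀ v : ℂ,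
      Integrable (fun z => f z * fderiv ℝ φ z v) ∧ Integrable (fun z => fderiv ℝ f z v * φ z) ∧
      ∫ z, f z * fderiv ℝ φ z v = -∫ z, fderiv ℝ f z v * φ z := by
    intro φ hφ hφc v
    have hφ' : Continuous fun z => fderiv ℝ φ z v :=
      (hφ.continuous_fderiv (by simp)).clm_apply continuous_const
    have i1 := hint _ (hloc v) φ hφ.continuous hφc
    have i2 := hint f hf.continuous.locallyIntegrable _ hφ' (hφc.fderiv_apply ℝ v)
    exact ⟨i2, i1, integral_mul_fderiv_eq_neg_fderiv_mul_of_integrable i1 i2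
      (hint f hf.continuous.locallyIntegrable φ hφ.continuous hφc)
      (fun x _ => hf x) (fun x _ => (hφ.differentiable (by simp)) x)⟩
  refine ⟨?_, ?_, ?_, ?_⟩
  · exact ((((hloc 1).sub ((hloc I).smul I)).smul (1 / 2 : ℂ)).congr (by
      filter_upwards with z; simp [wirtinger]; ring)).locallyIntegrableOn Ω
  · exact ((((hloc 1).add ((hloc I).smul I)).smul (1 / 2 : ℂ)).congr (by
      filter_upwards with z; simp [wirtingerBar]; ring)).locallyIntegrableOn Ω
  · intro φ hφ hφc _
    obtain ⟨a1, a2, a3⟩ := hparts φ hφ hφc 1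
    obtain ⟨b1, b2, b3⟩ := hparts φ hφ hφc I
    have e1 : ∀ z, f z * wirtinger φ z
        = (1 / 2) * (f z * fderiv ℝ φ z 1) - (I / 2) * (f z * fderiv ℝ φ z I) := fun z => by
      rw [wirtinger]; ring
    have e2 : ∀ z, wirtinger f z * φ z
        = (1 / 2) * (fderiv ℝ f z 1 * φ z) - (I / 2) * (fderiv ℝ f z I * φ z) := fun z => by
      rw [wirtinger]; ring
    simp only [e1, e2]
    rw [integral_sub (a1.const_mul _) (b1.const_mul _), integral_sub (a2.const_mul _)
      (b2.const_mul _), integral_const_mul, integral_const_mul, integral_const_mul,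
      integral_const_mul, a3, b3]
    ring
  · intro φ hφ hφc _
    obtain ⟨a1, a2, a3⟩ := hparts φ hφ hφc 1
    obtain ⟨b1, b2, b3⟩ := hparts φ hφ hφc I
    have e1 : ∀ z, f z * wirtingerBar φ z
        = (1 / 2) * (f z * fderiv ℝ φ z 1) + (I / 2) * (f z * fderiv ℝ φ z I) := fun z => by
      rw [wirtingerBar]; ring
    have e2 : ∀ z, wirtingerBar f z * φ z
        = (1 / 2) * (fderiv ℝ f z 1 * φ z) + (I / 2) * (fderiv ℝ f z I * φ z) := fun z => by
      rw [wirtingerBar]; ring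
    simp only [e1, e2]
    rw [integral_add (a1.const_mul _) (b1.const_mul _), integral_add (a2.const_mul _)
      (b2.const_mul _), integral_const_mul, integral_const_mul, integral_const_mul,
      integral_const_mul, a3, b3]
    ring

/-! ### A cutoff function -/

/-- Squares of positive parts are `C¹`. They combine into the quadratic spline `step`, whose
derivative is a tent on `[0,1]` of height 2, so that all constants are explicit. -/
lemma hasDerivAt_max_sq (t : ℝ) : HasDerivAt (fun t : ℝ => max 0 t ^ 2) (2 * max 0 t) t := by
  rcases lt_trichotomy t 0 with ht | rfl | ht
  · have : (fun t : ℝ => max 0 t ^ 2) =ᶠ[𝓝 t] fun _ => 0 := by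
      filter_upwards [gt_mem_nhds ht] with s hs
      simp [max_eq_left hs.le]
    rw [max_eq_left ht.le, mul_zero]
    exact (hasDerivAt_const t 0).congr_of_eventuallyEq this
  · rw [max_self, mul_zero, hasDerivAt_iff_isLittleO]
    simp only [max_self, sub_zero, smul_zero, ne_eq, OfNat.ofNat_ne_zero, not_false_eq_true,
      zero_pow]
    have h1 : (fun t : ℝ => max 0 t ^ 2) =O[𝓝 0] fun t : ℝ => t ^ 2 := by
      refine Asymptotics.IsBigO.of_bound 1 (.of_forall fun s => ?_)
      rw [one_mul, Real.norm_of_nonneg (by positivity), Real.norm_of_nonneg (by positivity)]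
      rcases le_total s 0 with hs | hs
      · simp [max_eq_left hs, sq_nonneg]
      · simp [max_eq_right hs]
    exact h1.trans_isLittleO (by simpa using Asymptotics.isLittleO_pow_pow (𝕜 := ℝ) one_lt_two)
  · have : (fun t : ℝ => max 0 t ^ 2) =ᶠ[𝓝 t] fun s => s ^ 2 := by
      filter_upwards [lt_mem_nhds ht] with s hs
      simp [max_eq_right hs.le]
    rw [max_eq_right ht.le]
    simpa using (hasDerivAt_pow 2 t).congr_of_eventuallyEq this

/-- A `C¹` step function: `0` for `t ≤ 0` and `1` for `t ≥ 1`. -/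
def step (t : ℝ) : ℝ := 2 * max 0 t ^ 2 - 4 * max 0 (t - 1 / 2) ^ 2 + 2 * max 0 (t - 1) ^ 2

/-- The derivative of `step`. -/
def stepDeriv (t : ℝ) : ℝ := 4 * max 0 t - 8 * max 0 (t - 1 / 2) + 4 * max 0 (t - 1)

lemma hasDerivAt_step (t : ℝ) : HasDerivAt step (stepDeriv t) t := by
  have h1 := hasDerivAt_max_sq t
  have h2 := (hasDerivAt_max_sq (t - 1 / 2)).comp_sub_const t (1 / 2)
  have h3 := (hasDerivAt_max_sq (t - 1)).comp_sub_const t 1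
  refine HasDerivAt.congr_deriv (f := step)
    (((h1.const_mul 2).sub (h2.const_mul 4)).add (h3.const_mul 2)) ?_
  rw [stepDeriv]
  ring

lemma step_of_nonpos {t : ℝ} (ht : t ≤ 0) : step t = 0 := by
  rw [step, max_eq_left ht, max_eq_left (by linarith : t - 1 / 2 ≤ 0),
    max_eq_left (by linarith : t - 1 ≤ 0)]
  ring

lemma stepDeriv_of_nonpos {t : ℝ} (ht : t ≤ 0) : stepDeriv t = 0 := by
  rw [stepDeriv, max_eq_left ht, max_eq_left (by linarith : t - 1 / 2 ≤ 0),
    max_eq_left (by linarith : t - 1 ≤ 0)]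
  ring

lemma step_of_one_le {t : ℝ} (ht : 1 ≤ t) : step t = 1 := by
  simp only [step, max_eq_right (by linarith : 0 ≤ t), max_eq_right (by linarith : 0 ≤ t - 1 / 2),
    max_eq_right (by linarith : 0 ≤ t - 1)]
  ring

lemma step_bounds (t : ℝ) : |step t| ≤ 1 ∧ |stepDeriv t| ≤ 2 := by
  simp only [step, stepDeriv, abs_le]
  rcases le_total t 0 with h1 | h1 <;> rcases le_total (t - 1 / 2) 0 with h2 | h2 <;>
    rcases le_total (t - 1) 0 with h3 | h3 <;> simp only [max_eq_left, max_eq_right, h1, h2, h3] <;>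
    refine ⟨⟨?_, ?_⟩, ?_, ?_⟩ <;> nlinarith

/-- A `C¹` cutoff function: `1` for `x² ≤ 3/2` and `0` for `x² ≥ 3`. -/
def cutoff (x : ℝ) : ℝ := step (2 - 2 / 3 * x ^ 2)

/-- The derivative of `cutoff`. -/
def cutoffDeriv (x : ℝ) : ℝ := stepDeriv (2 - 2 / 3 * x ^ 2) * (-(4 / 3 * x))

lemma hasDerivAt_cutoff (x : ℝ) : HasDerivAt cutoff (cutoffDeriv x) x := by
  have h1 : HasDerivAt (fun x : ℝ => 2 - 2 / 3 * x ^ 2) (-(4 / 3 * x)) x := by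
    have := ((hasDerivAt_pow 2 x).const_mul (2 / 3 : ℝ)).const_sub 2
    refine this.congr_deriv ?_
    push_cast
    ring
  exact (hasDerivAt_step _).comp x h1

lemma cutoff_eq_one {x : ℝ} (hx : x ^ 2 ≤ 3 / 2) : cutoff x = 1 := step_of_one_le (by linarith)

lemma cutoff_eq_zero {x : ℝ} (hx : 3 ≤ x ^ 2) : cutoff x = 0 := step_of_nonpos (by linarith)

lemma cutoffDeriv_eq_zero {x : ℝ} (hx : 3 ≤ x ^ 2) : cutoffDeriv x = 0 := by
  rw [cutoffDeriv, stepDeriv_of_nonpos (by linarith), zero_mul]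

lemma abs_cutoff_le (x : ℝ) : |cutoff x| ≤ 1 := (step_bounds _).1

/-- On the support `|x| ≤ √3 < 7/4`, so the chain rule gives at most `2 · 4/3 · 7/4 = 14/3`. -/
lemma abs_cutoffDeriv_le (x : ℝ) : |cutoffDeriv x| ≤ 5 := by
  rcases le_total 3 (x ^ 2) with h | h
  · simp [cutoffDeriv_eq_zero h]
  · have hx : |x| ≤ 7 / 4 := abs_le_of_sq_le_sq (by nlinarith) (by norm_num)
    rw [cutoffDeriv, abs_mul, abs_neg, abs_mul, abs_of_pos (by norm_num : (0 : ℝ) < 4 / 3)]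
    nlinarith [(step_bounds (2 - 2 / 3 * x ^ 2)).2, abs_nonneg (stepDeriv (2 - 2 / 3 * x ^ 2)),
      abs_nonneg x]

/-! ### Series of hyperbolic sines -/

/-- The series `∑ aₙ sinh (π (n + 1) z)`. -/
def sinhSeries (a : ℕ → ℝ) (z : ℂ) : ℂ := ∑' n : ℕ, (a n : ℂ) * sinh (Real.pi * (n + 1) * z)

lemma norm_sinh_le (w : ℂ) : ‖sinh w‖ ≤ Real.exp |w.re| := by
  rw [sinh, norm_div, Complex.norm_two, div_le_iff₀ two_pos]
  refine (norm_sub_le _ _).trans ?_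
  rw [norm_exp, norm_exp, neg_re]
  have h1 := Real.exp_le_exp.mpr (le_abs_self w.re)
  have h2 := Real.exp_le_exp.mpr (neg_le_abs w.re)
  linarith

section Series

variable {a : ℕ → ℝ} {L : ℝ}

/-- The width `5/2` leaves a margin of `1/2` beyond the region `|Re z| < 2` used by the cutoff, for
a Cauchy estimate of the derivative. -/
lemma norm_sinhSeries_term_le (ha : ∀ n, |a n| ≤ 4 * Real.exp (-(Real.pi * (n + 1) * L)))
    {z : ℂ} (hz : |z.re| ≤ 5 / 2) (n : ℕ) :
    ‖(a n : ℂ) * sinh (Real.pi * (n + 1) * z)‖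
      ≤ 4 * Real.exp (-(Real.pi * (L - 5 / 2))) ^ (n + 1) := by
  rw [norm_mul, norm_real, Real.norm_eq_abs]
  have h1 : |(Real.pi * (n + 1) * z : ℂ).re| ≤ Real.pi * (n + 1) * (5 / 2) := by
    have : (Real.pi * (n + 1) * z : ℂ).re = Real.pi * (n + 1) * z.re := by simp
    rw [this, abs_mul, abs_of_pos (by positivity)]
    gcongr
  have h2 := (norm_sinh_le (Real.pi * (n + 1) * z)).trans (Real.exp_le_exp.mpr h1)
  refine (mul_le_mul (ha n) h2 (norm_nonneg _) (by positivity)).trans (le_of_eq ?_)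
  rw [mul_assoc, ← Real.exp_add, ← Real.exp_nat_mul]
  congr 2
  push_cast
  ring

lemma hasSum_geometric_succ {q : ℝ} (h0 : 0 ≤ q) (h1 : q < 1) :
    HasSum (fun n : ℕ => 4 * q ^ (n + 1)) (4 * (q * (1 - q)⁻¹)) := by
  refine HasSum.mul_left 4 ?_
  simpa [pow_succ'] using (hasSum_geometric_of_lt_one h0 h1).mul_left q

lemma differentiableOn_sinhSeries (ha : ∀ n, |a n| ≤ 4 * Real.exp (-(Real.pi * (n + 1) * L)))
    (hL : Real.exp (-(Real.pi * (L - 5 / 2))) ≤ 1 / 50) :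
    DifferentiableOn ℂ (sinhSeries a) {z | |z.re| < 5 / 2} := by
  refine differentiableOn_tsum_of_summable_norm
    (hasSum_geometric_succ (Real.exp_pos _).le (hL.trans_lt (by norm_num))).summable
    (fun n => by fun_prop) (isOpen_lt (by fun_prop) continuous_const)
    (fun n w hw => norm_sinhSeries_term_le ha (le_of_lt hw) n)

lemma norm_sinhSeries_le (ha : ∀ n, |a n| ≤ 4 * Real.exp (-(Real.pi * (n + 1) * L)))
    (hL : Real.exp (-(Real.pi * (L - 5 / 2))) ≤ 1 / 50) {z : ℂ} (hz : |z.re| < 5 / 2) :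
    ‖sinhSeries a z‖ ≤ 5 * Real.exp (-(Real.pi * (L - 5 / 2))) := by
  set q := Real.exp (-(Real.pi * (L - 5 / 2)))
  have hq : 0 < q := Real.exp_pos _
  refine (tsum_of_norm_bounded (hasSum_geometric_succ hq.le (hL.trans_lt (by norm_num)))
    (norm_sinhSeries_term_le ha hz.le)).trans ?_
  rw [← mul_assoc, ← div_eq_mul_inv, div_le_iff₀ (by linarith)]
  nlinarith

lemma summable_sinhSeries (ha : ∀ n, |a n| ≤ 4 * Real.exp (-(Real.pi * (n + 1) * L)))
    (hL : Real.exp (-(Real.pi * (L - 5 / 2))) ≤ 1 / 50) {z : ℂ} (hz : |z.re| < 5 / 2) :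
    Summable fun n : ℕ => (a n : ℂ) * sinh (Real.pi * (n + 1) * z) :=
  .of_norm_bounded (hasSum_geometric_succ (Real.exp_pos _).le
    (hL.trans_lt (by norm_num))).summable (norm_sinhSeries_term_le ha hz.le)

lemma sinhSeries_im (ha : ∀ n, |a n| ≤ 4 * Real.exp (-(Real.pi * (n + 1) * L)))
    (hL : Real.exp (-(Real.pi * (L - 5 / 2))) ≤ 1 / 50) {z : ℂ} (hz : |z.re| < 5 / 2)
    (hz' : z.im = 0 ∨ z.im = 1) : (sinhSeries a z).im = 0 := by
  rw [sinhSeries, im_tsum (summable_sinhSeries ha hL hz)]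
  refine (tsum_congr fun n => ?_).trans tsum_zero
  have h1 : (Real.pi * (n + 1) * z : ℂ).im = (n + 1 : ℕ) * z.im * Real.pi := by
    simp; ring
  have h2 : Real.sin ((n + 1 : ℕ) * z.im * Real.pi) = 0 := by
    rcases hz' with h | h <;> rw [h]
    · simp
    · rw [mul_one, Real.sin_nat_mul_pi]
  rw [im_ofReal_mul, sinh]
  have h3 : (exp (Real.pi * (n + 1) * z)).im = 0 := by rw [exp_im, h1, h2, mul_zero]
  have h4 : (exp (-(Real.pi * (n + 1) * z))).im = 0 := by
    rw [exp_im, neg_im, h1, Real.sin_neg, h2, neg_zero, mul_zero]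
  rw [show (2 : ℂ) = (2 : ℝ) by simp, div_ofReal_im, sub_im, h3, h4]
  simp

lemma sinhSeries_re (ha : ∀ n, |a n| ≤ 4 * Real.exp (-(Real.pi * (n + 1) * L)))
    (hL : Real.exp (-(Real.pi * (L - 5 / 2))) ≤ 1 / 50) {z : ℂ} (hz : z.re = 0) :
    (sinhSeries a z).re = 0 := by
  rw [sinhSeries, re_tsum (summable_sinhSeries ha hL (by rw [hz]; norm_num))]
  refine (tsum_congr fun n => ?_).trans tsum_zero
  have h1 : (Real.pi * (n + 1) * z : ℂ).re = 0 := by simp [hz]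
  rw [re_ofReal_mul, sinh, show (2 : ℂ) = (2 : ℝ) by simp, div_ofReal_re, sub_re, exp_re, exp_re,
    neg_re, neg_im, h1, neg_zero, Real.cos_neg]
  simp

end Series

/-! ### Cutting off a small holomorphic function on a strip -/

/-- The product of `H` with a cutoff function in the horizontal direction. -/
def cut (H : ℂ → ℂ) (z : ℂ) : ℂ := cutoff z.re • H z

/-- `H` is holomorphic on a strip about the imaginary axis and bounded there by `5 q`, where
`q ≤ 1 / 50`. -/
structure IsSmallOnStrip (H : ℂ → ℂ) (q : ℝ) : Prop where
  nonneg : 0 ≤ q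
  le : q ≤ 1 / 50
  holo : DifferentiableOn ℂ H {z | |z.re| < 5 / 2}
  bound : ∀ z : ℂ, |z.re| < 5 / 2 → ‖H z‖ ≤ 5 * q

lemma cut_of_two_le {H : ℂ → ℂ} {z : ℂ} (hz : 2 ≤ z.re) : cut H z = 0 := by
  rw [cut, cutoff_eq_zero (by nlinarith), zero_smul]

namespace IsSmallOnStrip

variable {H : ℂ → ℂ} {q : ℝ}

lemma isOpen_strip (r : ℝ) : IsOpen {z : ℂ | |z.re| < r} :=
  isOpen_lt (by fun_prop) continuous_const

/-- Cauchy's estimate on discs of radius `1/2`. -/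
lemma norm_deriv_le (hH : IsSmallOnStrip H q) {z : ℂ} (hz : |z.re| < 2) :
    ‖deriv H z‖ ≤ 10 * q := by
  have hsub : Metric.closedBall z (1 / 2) ⊆ {z : ℂ | |z.re| < 5 / 2} := by
    intro w hw
    have h1 : |(w - z).re| ≤ 1 / 2 :=
      (abs_re_le_norm _).trans (by rwa [Metric.mem_closedBall, dist_eq_norm] at hw)
    rw [sub_re] at h1
    have h2 := abs_sub_abs_le_abs_sub w.re z.re
    rw [mem_ofPred_eq]
    linarith
  have := norm_deriv_le_of_forall_mem_sphere_norm_le (c := z) (R := 1 / 2) (C := 5 * q) (f := H)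
    (by norm_num) ((hH.holo.mono hsub).diffContOnCl_ball subset_rfl)
    (fun w hw => hH.bound w (hsub (Metric.sphere_subset_closedBall hw)))
  linarith

/-- The formula holds on the whole plane although `H` is controlled only on the strip: for `|Re z| ≥
2` the cutoff vanishes near `z`, since `2² > 3`. -/
lemma hasFDerivAt_cut (hH : IsSmallOnStrip H q) (z : ℂ) :
    HasFDerivAt (cut H) (cutoff z.re • (ContinuousLinearMap.toSpanSingleton ℂ (deriv H z)).restrictScalars ℝ
      + (cutoffDeriv z.re • reCLM).smulRight (H z)) z := by
  rcases lt_or_ge |z.re| 2 with hz | hz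
  · have h1 : HasFDerivAt H ((ContinuousLinearMap.toSpanSingleton ℂ (deriv H z)).restrictScalars ℝ) z :=
      ((hH.holo.differentiableAt ((isOpen_strip _).mem_nhds (by
        rw [mem_ofPred_eq]; linarith))).hasDerivAt.hasFDerivAt).restrictScalars ℝ
    have h2 : HasFDerivAt (fun z : ℂ => cutoff z.re) (cutoffDeriv z.re • reCLM) z :=
      (hasDerivAt_cutoff z.re).comp_hasFDerivAt z reCLM.hasFDerivAt
    exact h2.smul h1
  · have hsq : 3 < z.re ^ 2 := by
      rw [← sq_abs]; nlinarith
    have : cut H =ᶠ[𝓝 z] fun _ => 0 := by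
      have ho : IsOpen {w : ℂ | 3 < w.re ^ 2} := isOpen_lt continuous_const (by fun_prop)
      filter_upwards [ho.mem_nhds hsq] with w hw
      rw [cut, cutoff_eq_zero (le_of_lt hw), zero_smul]
    rw [cutoff_eq_zero hsq.le, cutoffDeriv_eq_zero hsq.le]
    refine ((hasFDerivAt_const (0 : ℂ) z).congr_of_eventuallyEq this).congr_fderiv ?_
    ext v
    simp

lemma norm_cutoff_mul_deriv_le (hH : IsSmallOnStrip H q) (z : ℂ) :
    ‖(cutoff z.re : ℂ) * deriv H z‖ ≤ 10 * q := by
  have hq := hH.nonneg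
  rw [norm_mul, norm_real, Real.norm_eq_abs]
  rcases lt_or_ge |z.re| 2 with hz | hz
  · nlinarith [abs_cutoff_le z.re, hH.norm_deriv_le hz, norm_nonneg (deriv H z),
      abs_nonneg (cutoff z.re)]
  · rw [cutoff_eq_zero (by rw [← sq_abs]; nlinarith)]
    simp [hq]

lemma norm_cutoffDeriv_mul_le (hH : IsSmallOnStrip H q) (z : ℂ) :
    ‖(cutoffDeriv z.re : ℂ) * H z‖ ≤ 25 * q := by
  have hq := hH.nonneg
  rw [norm_mul, norm_real, Real.norm_eq_abs]
  rcases lt_or_ge |z.re| 2 with hz | hz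
  · nlinarith [abs_cutoffDeriv_le z.re, hH.bound z (by linarith), norm_nonneg (H z),
      abs_nonneg (cutoffDeriv z.re)]
  · rw [cutoffDeriv_eq_zero (by rw [← sq_abs]; nlinarith)]
    simp [hq]

lemma fderiv_cut_apply (hH : IsSmallOnStrip H q) (z v : ℂ) :
    fderiv ℝ (cut H) z v = cutoff z.re * deriv H z * v + cutoffDeriv z.re * H z * v.re := by
  rw [(hH.hasFDerivAt_cut z).fderiv]
  simp
  ring

lemma differentiable_cut (hH : IsSmallOnStrip H q) : Differentiable ℝ (cut H) :=
  fun z => (hH.hasFDerivAt_cut z).differentiableAt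

lemma norm_fderiv_cut_le (hH : IsSmallOnStrip H q) (z : ℂ) : ‖fderiv ℝ (cut H) z‖ ≤ 35 * q := by
  have hq := hH.nonneg
  refine ContinuousLinearMap.opNorm_le_bound _ (by positivity) fun v => ?_
  rw [hH.fderiv_cut_apply]
  refine (norm_add_le _ _).trans ?_
  rw [norm_mul, norm_mul _ (v.re : ℂ), norm_real, Real.norm_eq_abs]
  have h1 := hH.norm_cutoff_mul_deriv_le z
  have h2 := hH.norm_cutoffDeriv_mul_le z
  have h3 := abs_re_le_norm v
  have h4 := norm_nonneg v
  calc _ ≤ 10 * q * ‖v‖ + 25 * q * ‖v‖ := by gcongr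
    _ = _ := by ring

/-- The constant is `35 q` at the largest allowed value `q = 1/50`. -/
lemma lipschitzWith_cut (hH : IsSmallOnStrip H q) : LipschitzWith (7 / 10) (cut H) := by
  refine lipschitzWith_of_nnnorm_fderiv_le hH.differentiable_cut fun z => ?_
  rw [← NNReal.coe_le_coe, coe_nnnorm]
  refine (hH.norm_fderiv_cut_le z).trans ?_
  have := hH.le
  push_cast
  linarith

lemma fderiv_id_add_cut (hH : IsSmallOnStrip H q) (z : ℂ) :
    fderiv ℝ (fun z => z + cut H z) z = ContinuousLinearMap.id ℝ ℂ + fderiv ℝ (cut H) z :=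
  ((hasFDerivAt_id z).add (hH.differentiable_cut z).hasFDerivAt).fderiv

/-- Since `∂̄H = 0`, only the derivative of the cutoff contributes. -/
lemma wirtingerBar_eq (hH : IsSmallOnStrip H q) (z : ℂ) :
    wirtingerBar (fun z => z + cut H z) z = cutoffDeriv z.re * H z / 2 := by
  rw [wirtingerBar, hH.fderiv_id_add_cut]
  simp only [add_apply, ContinuousLinearMap.id_apply, hH.fderiv_cut_apply,
    one_re, I_re, ofReal_one, ofReal_zero]
  linear_combination (1 + cutoff z.re * deriv H z) / 2 * I_mul_I

lemma wirtinger_eq (hH : IsSmallOnStrip H q) (z : ℂ) :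
    wirtinger (fun z => z + cut H z) z
      = 1 + cutoff z.re * deriv H z + cutoffDeriv z.re * H z / 2 := by
  rw [wirtinger, hH.fderiv_id_add_cut]
  simp only [add_apply, ContinuousLinearMap.id_apply, hH.fderiv_cut_apply,
    one_re, I_re, ofReal_one, ofReal_zero]
  linear_combination -(1 + cutoff z.re * deriv H z) / 2 * I_mul_I

/-- `|∂̄α| ≤ 25q/2`, while `|∂α| ≥ 1 - 10q - 25q/2 ≥ 1/2`. -/
lemma norm_wirtingerBar_le (hH : IsSmallOnStrip H q) (z : ℂ) :
    ‖wirtingerBar (fun z => z + cut H z) z‖ ≤ 25 * q * ‖wirtinger (fun z => z + cut H z) z‖ := by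
  rw [hH.wirtingerBar_eq, hH.wirtinger_eq]
  have h1 := hH.norm_cutoff_mul_deriv_le z
  have h2 := hH.norm_cutoffDeriv_mul_le z
  have hq := hH.nonneg
  have hq' := hH.le
  set u := (cutoff z.re : ℂ) * deriv H z
  set v := (cutoffDeriv z.re : ℂ) * H z
  have h3 : ‖v / 2‖ ≤ 25 / 2 * q := by
    rw [norm_div, Complex.norm_two]; linarith
  have h4 : 1 / 2 ≤ ‖1 + u + v / 2‖ := by
    have e : (1 : ℂ) = (1 + u + v / 2) - u - v / 2 := by ring
    have := norm_sub_le (1 + u + v / 2 - u) (v / 2)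
    have h5 := norm_sub_le (1 + u + v / 2) u
    rw [← e, norm_one] at this
    linarith
  nlinarith

lemma isWeakWirtinger (hH : IsSmallOnStrip H q) (Ω : Set ℂ) :
    IsWeakWirtinger (fun z => z + cut H z) Ω (wirtinger fun z => z + cut H z)
      (wirtingerBar fun z => z + cut H z) := by
  refine isWeakWirtinger_of_differentiable (differentiable_id.add hH.differentiable_cut)
    (B := 1 + 35 * q) (fun z => ?_) Ω
  have : fderiv ℝ (fun z => id z + cut H z) z
      = ContinuousLinearMap.id ℝ ℂ + fderiv ℝ (cut H) z := hH.fderiv_id_add_cut z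
  refine (congrArg norm this).le.trans ((norm_add_le _ _).trans ?_)
  exact add_le_add ContinuousLinearMap.norm_id_le (hH.norm_fderiv_cut_le z)

/-- The plane homeomorphism `z ↦ z + cut H z`. -/
def homeo (hH : IsSmallOnStrip H q) : ℂ ≃ₜ ℂ :=
  perturbHomeo hH.lipschitzWith_cut (by rw [← NNReal.coe_lt_coe]; norm_num)

lemma homeo_apply (hH : IsSmallOnStrip H q) (z : ℂ) : hH.homeo z = z + cut H z := rfl

lemma homeo_of_two_le (hH : IsSmallOnStrip H q) {z : ℂ} (hz : 2 ≤ z.re) : hH.homeo z = z := by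
  rw [homeo_apply, cut_of_two_le hz, add_zero]

lemma two_le_re_homeo_iff (hH : IsSmallOnStrip H q) (z : ℂ) :
    2 ≤ (hH.homeo z).re ↔ 2 ≤ z.re := by
  refine ⟨fun h => ?_, fun h => by rwa [hH.homeo_of_two_le h]⟩
  rwa [hH.homeo.injective (hH.homeo_of_two_le h)] at h

lemma cut_im (hH : ∀ z : ℂ, |z.re| < 5 / 2 → z.im = 0 ∨ z.im = 1 → (H z).im = 0) {z : ℂ}
    (hz : z.im = 0 ∨ z.im = 1) : (cut H z).im = 0 := by
  rcases lt_or_ge |z.re| 2 with h | h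
  · rw [cut, smul_im, hH z (by linarith) hz, smul_zero]
  · rw [cut, cutoff_eq_zero (by rw [← sq_abs]; nlinarith), zero_smul, zero_im]

lemma cut_re (hH : ∀ z : ℂ, z.re = 0 → (H z).re = 0) {z : ℂ}
    (hz : z.re = 0) : (cut H z).re = 0 := by
  rw [cut, smul_re, hH z hz, smul_zero]

/-- Comparison with the projection of `z` to the line `Im = k`, where the perturbation is real: a
point moves vertically by at most `7/10` of its distance to the line, so it can neither reach nor
cross it. -/
lemma abs_im_sub_le (hH : IsSmallOnStrip H q)
    (him : ∀ z : ℂ, |z.re| < 5 / 2 → z.im = 0 ∨ z.im = 1 → (H z).im = 0) {k : ℝ}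
    (hk : k = 0 ∨ k = 1) (z : ℂ) :
    |((hH.homeo z).im - k) - (z.im - k)| ≤ 7 / 10 * |z.im - k| := by
  have h1 := hH.lipschitzWith_cut.dist_le_mul z ⟨z.re, k⟩
  rw [dist_eq_norm, dist_eq_norm] at h1
  have h2 : (cut H ⟨z.re, k⟩).im = 0 := cut_im him hk
  have h3 := (abs_im_le_norm _).trans h1
  have h4 : z - ⟨z.re, k⟩ = ((z.im - k : ℝ) : ℂ) * I := by
    apply Complex.ext <;> simp
  rw [h4, sub_im, h2, norm_mul, norm_I, mul_one, norm_real, Real.norm_eq_abs] at h3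
  have h5 : ((hH.homeo z).im - k) - (z.im - k) = (cut H z).im - 0 := by
    rw [homeo_apply, add_im]; ring
  rw [h5]
  simpa using h3

lemma abs_re_sub_le (hH : IsSmallOnStrip H q) (hre : ∀ z : ℂ, z.re = 0 → (H z).re = 0) (z : ℂ) :
    |(hH.homeo z).re - z.re| ≤ 7 / 10 * |z.re| := by
  have h1 := hH.lipschitzWith_cut.dist_le_mul z ⟨0, z.im⟩
  rw [dist_eq_norm, dist_eq_norm] at h1
  have h2 : (cut H ⟨0, z.im⟩).re = 0 := cut_re hre rfl
  have h3 := (abs_re_le_norm _).trans h1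
  have h4 : z - ⟨0, z.im⟩ = ((z.re : ℝ) : ℂ) := by
    apply Complex.ext <;> simp
  rw [h4, sub_re, h2, norm_real, Real.norm_eq_abs] at h3
  have h5 : (hH.homeo z).re - z.re = (cut H z).re - 0 := by
    rw [homeo_apply, add_re]; ring
  rw [h5]
  simpa using h3

end IsSmallOnStrip

lemma sign_iff_of_abs_sub_le {s t : ℝ} (h : |s - t| ≤ 7 / 10 * |t|) :
    (0 < s ↔ 0 < t) ∧ (0 ≤ s ↔ 0 ≤ t) := by
  rw [abs_le] at h
  rcases lt_trichotomy t 0 with ht | rfl | ht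
  · rw [abs_of_neg ht] at h
    exact ⟨⟨fun _ => by linarith, fun _ => by linarith⟩, fun _ => by linarith, fun _ => by linarith⟩
  · rw [abs_zero] at h
    have : s = 0 := by linarith
    simp [this]
  · rw [abs_of_pos ht] at h
    exact ⟨⟨fun _ => by linarith, fun _ => by linarith⟩, fun _ => by linarith, fun _ => by linarith⟩

/-! ### Invariant sets and quasiconformality of the perturbed identity -/

namespace IsSmallOnStrip

variable {H : ℂ → ℂ} {q : ℝ}

lemma homeo_mem_halfStrip_iff (hH : IsSmallOnStrip H q)
    (him : ∀ z : ℂ, |z.re| < 5 / 2 → z.im = 0 ∨ z.im = 1 → (H z).im = 0)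
    (hre : ∀ z : ℂ, z.re = 0 → (H z).re = 0) (z : ℂ) :
    (0 ≤ (hH.homeo z).re ∧ (hH.homeo z).im ∈ Icc (0 : ℝ) 1 ↔ 0 ≤ z.re ∧ z.im ∈ Icc (0 : ℝ) 1) ∧
    (0 < (hH.homeo z).re ∧ (hH.homeo z).im ∈ Ioo (0 : ℝ) 1 ↔ 0 < z.re ∧ z.im ∈ Ioo (0 : ℝ) 1) := by
  have h1 := sign_iff_of_abs_sub_le (hH.abs_re_sub_le hre z)
  have h2 := sign_iff_of_abs_sub_le (hH.abs_im_sub_le him (.inl rfl) z)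
  have h3 := sign_iff_of_abs_sub_le (hH.abs_im_sub_le him (.inr rfl) z)
  simp only [sub_zero] at h2
  simp only [sub_nonneg, sub_pos] at h3
  have h4 : (hH.homeo z).im < 1 ↔ z.im < 1 := by rw [← not_le, ← not_le, h3.2]
  have h5 : (hH.homeo z).im ≤ 1 ↔ z.im ≤ 1 := by rw [← not_lt, ← not_lt, h3.1]
  exact ⟨and_congr h1.2 (and_congr h2.2 h5), and_congr h1.1 (and_congr h2.1 h4)⟩

/-- A set that agrees with an invariant set in the half plane `Re < 2` is invariant. -/
lemma homeo_mem_iff (hH : IsSmallOnStrip H q) {S Q : Set ℂ}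
    (hQ : ∀ z, hH.homeo z ∈ Q ↔ z ∈ Q) (hS : ∀ z : ℂ, z.re < 2 → (z ∈ S ↔ z ∈ Q)) (z : ℂ) :
    hH.homeo z ∈ S ↔ z ∈ S := by
  rcases le_or_gt 2 z.re with h | h
  · rw [hH.homeo_of_two_le h]
  · have h' : (hH.homeo z).re < 2 := by
      rw [← not_le] at h ⊢
      rwa [hH.two_le_re_homeo_iff]
    rw [hS z h, hS _ h', hQ]

lemma bijOn_homeo (hH : IsSmallOnStrip H q) {S : Set ℂ} (hS : ∀ z, hH.homeo z ∈ S ↔ z ∈ S) :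
    BijOn hH.homeo S S :=
  ⟨fun z hz => (hS z).mpr hz, hH.homeo.injective.injOn, fun w hw =>
    ⟨hH.homeo.symm w, (hS _).mp (by rwa [hH.homeo.apply_symm_apply]),
      hH.homeo.apply_symm_apply w⟩⟩

/-- `z ↦ z + cut H z` is quasiconformal on every open set it leaves invariant. -/
lemma isQuasiconformal (hH : IsSmallOnStrip H q) {Ω : Set ℂ} (hΩ : IsOpen Ω)
    (hS : ∀ z, hH.homeo z ∈ Ω ↔ z ∈ Ω) :
    IsQuasiconformal ((1 + 25 * q) / (1 - 25 * q)) hH.homeo Ω Ω := by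
  have hq := hH.nonneg
  have hq' := hH.le
  have hpos : 0 < 1 - 25 * q := by linarith
  refine ⟨?_, ⟨(hH.homeo.toOpenPartialHomeomorph).restrOpen Ω hΩ, ?_, ?_, ?_⟩, ?_, ?_⟩
  · rw [one_le_div hpos]; linarith
  · simp
  · ext w
    have := hS (hH.homeo.symm w)
    rw [hH.homeo.apply_symm_apply] at this
    simp [this]
  · intro z _
    simp
  · exact orientationPreservingOn_id_add hH.lipschitzWith_cut
      (by rw [← NNReal.coe_lt_coe]; norm_num) Ω
  · refine ⟨_, _, hH.isWeakWirtinger Ω, .of_forall fun z => ?_⟩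
    have : ((1 + 25 * q) / (1 - 25 * q) - 1) / ((1 + 25 * q) / (1 - 25 * q) + 1) = 25 * q := by
      field_simp
      ring
    rw [this]
    exact hH.norm_wirtingerBar_le z

lemma dilatationSupportedIn (hH : IsSmallOnStrip H q) {Ω : Set ℂ} {m : ℝ} (hm : 2 ≤ m)
    (hΩ : ∀ z ∈ Ω, 0 ≤ z.re ∧ z.im ∈ Icc (0 : ℝ) 1) (hΩm : MeasurableSet Ω) :
    DilatationSupportedIn hH.homeo Ω (rect m) := by
  refine ⟨_, ⟨_, _, hH.isWeakWirtinger Ω, .of_forall fun z => rfl⟩, ?_⟩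
  filter_upwards [ae_restrict_mem hΩm] with z hz hzm
  have h2 : 2 ≤ z.re := by
    by_contra! hcon
    exact hzm ⟨⟨(hΩ z hz).1, by linarith⟩, (hΩ z hz).2⟩
  rw [hH.wirtingerBar_eq, cutoffDeriv_eq_zero (by nlinarith)]
  simp

end IsSmallOnStrip

/-! ### Application to the inverse of a conformal embedding -/

/-- Near the left side, the inverse of a conformal embedding differs from the identity by a small
function that is holomorphic on a strip, real on the lines `Im = 0, 1` and imaginary on the
imaginary axis. -/
theorem IsConformalEmbedding.exists_isSmallOnStrip {R T L : ℝ} {E : ℂ → ℂ}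
    (h : IsConformalEmbedding R T E) (hL4 : 4 ≤ L) (hLT : L < T) (hL : rect L ⊆ E '' rect R) :
    ∃ H : ℂ → ℂ, IsSmallOnStrip H (Real.exp (-(Real.pi * (L - 5 / 2)))) ∧
      (∀ z : ℂ, |z.re| < 5 / 2 → z.im = 0 ∨ z.im = 1 → (H z).im = 0) ∧
      (∀ z : ℂ, z.re = 0 → (H z).re = 0) ∧
      ∀ z ∈ rect R, E z ∈ rect 2 → E z + H (E z) = z := by
  obtain ⟨F, hFc, hFd, hFm, hFE, hF0, hF1, hFl⟩ := h.exists_inverse hLT hL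
  obtain ⟨a, ha, hsum⟩ := exists_hasSum_sinh (G := fun w => F w - w) (by linarith : 0 < L)
    (hFc.sub continuousOn_id) (hFd.sub differentiableOn_id)
    (fun w hw hw0 => by rw [sub_im, hF0 w hw hw0, hw0, sub_zero])
    (fun w hw hw1 => by rw [sub_im, hF1 w hw hw1, hw1, sub_self])
    (fun w hw hw0 => by rw [sub_re, hFl w hw hw0, hw0, sub_zero])
    (fun w hw => by
      rw [sub_im, abs_le]
      have h1 := (hFm hw).2
      have h2 := hw.2
      constructor <;> linarith [h1.1, h1.2, h2.1, h2.2])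
  have hq : Real.exp (-(Real.pi * (L - 5 / 2))) ≤ 1 / 50 := by
    -- From `L ≥ 4`, `π(L - 5/2) ≥ 3π/2 > 4`, and `e⁴ > 50`.
    have h1 : Real.exp (-(Real.pi * (L - 5 / 2))) ≤ Real.exp (-4) := by
      gcongr
      nlinarith [Real.pi_gt_three]
    refine h1.trans ?_
    rw [Real.exp_neg, one_div]
    gcongr
    have h2 : Real.exp 4 = Real.exp 1 ^ 4 := by rw [← Real.exp_nat_mul]; norm_num
    rw [h2]
    calc (50 : ℝ) ≤ 2.7 ^ 4 := by norm_num
      _ ≤ _ := by gcongr; linarith [Real.exp_one_gt_d9]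
  refine ⟨sinhSeries a, ⟨(Real.exp_pos _).le, hq, differentiableOn_sinhSeries ha hq,
    fun z hz => norm_sinhSeries_le ha hq hz⟩, fun z hz hz' => sinhSeries_im ha hq hz hz',
    fun z hz => sinhSeries_re ha hq hz, fun z hz hEz => ?_⟩
  have := (hsum (E z) (rect_mono (by linarith) hEz) (by linarith [hEz.1.2])).tsum_eq
  rw [sinhSeries, this, hFE z hz]
  ring

/-- If the inverse of a conformal embedding is close to the identity, the embedding maps the unit
square into a slightly larger rectangle. -/
lemma IsConformalEmbedding.re_image_unitSquare_le {R T q : ℝ} {E H : ℂ → ℂ}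
    (h : IsConformalEmbedding R T E) (hT : 2 ≤ T) (hH : IsSmallOnStrip H q)
    (hEH : ∀ z ∈ rect R, E z ∈ rect 2 → E z + H (E z) = z) {z : ℂ} (hz : z ∈ rect 1) :
    (E z).re ≤ 6 / 5 := by
  by_contra! hcon
  have hR : 1 ≤ R := by linarith [h.lt]
  have hmem : ∀ t ∈ Icc (0 : ℝ) 1, (⟨t * z.re, z.im⟩ : ℂ) ∈ rect R := fun t ht =>
    ⟨⟨mul_nonneg ht.1 hz.1.1, by
      change t * z.re ≤ R
      nlinarith [ht.1, ht.2, hz.1.1, hz.1.2]⟩, hz.2⟩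
  have hc : ContinuousOn (fun t : ℝ => (E ⟨t * z.re, z.im⟩).re) (Icc 0 1) := by
    refine continuous_re.comp_continuousOn (h.continuousOn.comp ?_ hmem)
    have : (fun t : ℝ => (⟨t * z.re, z.im⟩ : ℂ)) = fun t : ℝ => (t * z.re : ℂ) + z.im * I := by
      funext t
      apply Complex.ext <;> simp
    rw [this]
    fun_prop
  have h0 : (E ⟨0 * z.re, z.im⟩).re = 0 := by
    have : E ⟨0 * z.re, z.im⟩ ∈ vertSide 0 :=
      h.left_side ▸ mem_image_of_mem E ⟨zero_mul _, hz.2⟩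
    exact this.1
  -- `hEH` applies only once `E` is known to land in `rect 2`, so a point with `Re E = 6/5` exactly
  -- is found on the horizontal segment from the left side to `z`. There the identity gives abscissa
  -- at least `6/5 - 5q ≥ 11/10`, yet the abscissa is at most `1`.
  obtain ⟨t, ht, hte⟩ := intermediate_value_Icc zero_le_one hc
    (show (6 / 5 : ℝ) ∈ Icc _ _ from ⟨by rw [h0]; norm_num, by
      rw [one_mul]; exact hcon.le⟩)
  beta_reduce at hte
  have hET := h.mapsTo (hmem t ht)
  have hE := hEH _ (hmem t ht) ⟨⟨hET.1.1, by rw [hte]; norm_num⟩, hET.2⟩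
  have hb := (abs_re_le_norm _).trans
    (hH.bound (E ⟨t * z.re, z.im⟩) (by rw [hte]; norm_num [abs_lt]))
  have hre := congrArg re hE
  rw [add_re, hte] at hre
  change 6 / 5 + (H (E ⟨t * z.re, z.im⟩)).re = t * z.re at hre
  rw [abs_le] at hb
  nlinarith [hH.le, ht.1, ht.2, hz.1.1, hz.1.2, hb.1]

/-- The exponential bound for the maximal dilatation. -/
lemma dilatation_lt (M : ℕ) (hM : 2 ≤ M) {q : ℝ}
    (hq : q = Real.exp (-(Real.pi * (2 * (M : ℝ) - 5 / 2)))) (hq' : q ≤ 1 / 50) :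
    (1 + 25 * q) / (1 - 25 * q) < 1 + 101 * Real.exp (2 * Real.pi) *
      (Real.exp (-(Real.pi * ((M : ℝ) - 1) / 2)) / M) := by
  have hM0 : (0 : ℝ) < M := by exact_mod_cast (by omega : 0 < M)
  have hq0 : 0 < q := hq ▸ Real.exp_pos _
  -- `(1 + x)/(1 - x) ≤ 1 + 4x` for `0 ≤ x ≤ 1/2`; the constant 101 then makes the final inequality
  -- strict.
  have h1 : (1 + 25 * q) / (1 - 25 * q) ≤ 1 + 100 * q := by
    rw [div_le_iff₀ (by linarith)]
    nlinarith
  -- With `M ≤ exp M`, the exponents compare as `-2πM + 5π/2 + M ≤ 5π/2 - πM/2`; the factor `exp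
  -- (2π)` matches the constant terms.
  have h2 : q * M ≤ Real.exp (2 * Real.pi) * Real.exp (-(Real.pi * ((M : ℝ) - 1) / 2)) := by
    have h3 : (M : ℝ) ≤ Real.exp M := by linarith [Real.add_one_le_exp (M : ℝ)]
    calc q * M ≤ q * Real.exp M := by gcongr
      _ ≤ _ := by
        rw [hq, ← Real.exp_add, ← Real.exp_add]
        refine Real.exp_le_exp.mpr ?_
        nlinarith [Real.pi_gt_three]
  have h4 : q ≤ Real.exp (2 * Real.pi) * (Real.exp (-(Real.pi * ((M : ℝ) - 1) / 2)) / M) := by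
    rw [← mul_div_assoc, le_div_iff₀ hM0]
    exact h2
  linarith

end AdmissibleShapes

end


/-! ### Assembly of the admissible map -/

open AdmissibleShapes

theorem mainTheorem8 :
    ∃ C : ℝ, 0 < C ∧ ∀ (T R : ℝ) (M : ℕ) (E : ℂ → ℂ), 6 ≤ T → 2 ≤ M → 2 * (M : ℝ) < T →
      AdmissibleShapes.IsConformalEmbedding R T E →
      AdmissibleShapes.rect (2 * (M : ℝ)) ⊆ E '' AdmissibleShapes.rect R →
      ∃ α : ℂ → ℂ,
        AdmissibleShapes.IsAdmissibleMap
          (C * (Real.exp (-(Real.pi * ((M : ℝ) - 1) / 2)) / (M : ℝ))) R T E α ∧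
        AdmissibleShapes.DilatationSupportedIn α (E '' AdmissibleShapes.openRect R)
          (AdmissibleShapes.rect (M : ℝ)) := by
  refine ⟨101 * Real.exp (2 * Real.pi), by positivity, ?_⟩
  intro T R M E hT hM hMT h hsub
  have hM' : (2 : ℝ) ≤ M := by exact_mod_cast hM
  obtain ⟨H, hH, him, hre, hEH⟩ := h.exists_isSmallOnStrip (by linarith) hMT hsub
  have hopen := h.openRect_subset_image hsub
  have hiff := hH.homeo_mem_halfStrip_iff him hre
  -- Left of `Re = 2 < 2M` the shape fills the whole half-strip: it contains `rect (2M)` and lies in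
  -- `rect T`.
  have hclosedInv : ∀ z, hH.homeo z ∈ E '' rect R ↔ z ∈ E '' rect R := by
    refine hH.homeo_mem_iff (Q := {z | 0 ≤ z.re ∧ z.im ∈ Icc (0 : ℝ) 1}) (fun z => (hiff z).1)
      fun z hz => ⟨?_, fun hzQ => hsub ⟨⟨hzQ.1, by linarith⟩, hzQ.2⟩⟩
    rintro ⟨w, hw, rfl⟩
    exact ⟨(h.mapsTo hw).1.1, (h.mapsTo hw).2⟩
  have hopenInv : ∀ z, hH.homeo z ∈ E '' openRect R ↔ z ∈ E '' openRect R := by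
    refine hH.homeo_mem_iff (Q := {z | 0 < z.re ∧ z.im ∈ Ioo (0 : ℝ) 1}) (fun z => (hiff z).2)
      fun z hz => ⟨fun hzS => ?_, fun hzQ => hopen ⟨⟨hzQ.1, by linarith⟩, hzQ.2⟩⟩
    have := h.image_openRect_subset hzS
    exact ⟨this.1.1, this.2⟩
  have hsquare : ∀ z ∈ rect R, (E z).re ≤ 6 / 5 → hH.homeo (E z) = z := by
    intro z hz hz'
    have h0 := (h.mapsTo hz).1.1
    -- `(6/5)² = 1.44 ≤ 3/2`, so the cutoff equals `1` and the map is `E⁻¹` here.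
    rw [hH.homeo_apply, cut, cutoff_eq_one (by nlinarith), one_smul]
    exact hEH z hz ⟨⟨h0, by linarith⟩, (h.mapsTo hz).2⟩
  have hR := h.R_pos
  refine ⟨hH.homeo, ⟨h, (rect_mono (by linarith)).trans hsub, hH.homeo.continuous.continuousOn,
    hH.bijOn_homeo hclosedInv, ?_, ?_, ?_⟩, ?_⟩
  · rintro v (rfl | rfl | rfl | rfl)
    · rw [hsquare 0 ⟨by simp [hR.le], by simp⟩ (by rw [h.map_zero]; norm_num), h.map_zero]
    -- The right quad-vertices have abscissa `T ≥ 6`, where the map is the identity.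
    · exact hH.homeo_of_two_le (by rw [h.re_p₁]; linarith)
    · exact hH.homeo_of_two_le (by rw [h.re_p₂]; linarith)
    · rw [hsquare Complex.I ⟨by simp [hR.le], by simp⟩ (by rw [h.map_I]; norm_num), h.map_I]
  · intro z hz
    exact hsquare z (rect_mono (by linarith [h.lt]) hz)
      (h.re_image_unitSquare_le (by linarith) hH hEH hz)
  · exact ⟨_, dilatation_lt M hM rfl hH.le, hH.isQuasiconformal h.isOpen_image_openRect hopenInv⟩
  · refine hH.dilatationSupportedIn hM' (fun z hz => ?_) h.isOpen_image_openRect.measurableSet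
    have := openRect_subset_rect _ (h.image_openRect_subset hz)
    exact ⟨this.1.1, this.2⟩
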